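/- All algebras are complex and unital. A Hopf $*$-algebra is a Hopf algebra $H$ with a conjugate linear, involutive algebra anti-automorphism $*$ such that the comultiplication and the counit are $*$-homomorphisms. A matrix $u=(u_{ij})\in M_n(H)$ is the coefficient matrix of an $n$-dimensional comodule if $\Delta(u_{ij})=\sum_k u_{ik}\otimes u_{kj}$ and $\varepsilon(u_{ij})=\delta_{ij}$ (the coaction being $e_j\mapsto\sum_i e_i\otimes u_{ij}$), and the comodule is unitary, with orthonormal basis $(e_i)$, if $u$ is a unitary element of $M_n(H)$. A CQG algebra is a Hopf $*$-algebra that is the linear span of the coefficients of its unitary finite-dimensional comodules; $\mathrm{CQG}$ is the category of CQG algebras and Hopf $*$-algebra morphisms. For a positive invertible matrix $Q\in GL_n(\mathbb C)$, $A_u(Q)$ is the $*$-algebra freely generated by elements $u_{ij}$, $1\le i,j\le n$, subject to the relations making both $u=(u_{ij})$ and $Q^{1/2}\overline{u}Q^{-1/2}$ unitary, where $\overline{u}=(u_{ij}^*)$; it is a CQG algebra with $\Delta(u_{ij})=\sum_k u_{ik}\otimes u_{kj}$ and $\varepsilon(u_{ij})=\delta_{ij}$. An object $x$ of a category $\mathcal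 C$ is finitely presentable if $\mathcal C(x,-)$ preserves filtered colimits. A set $S$ of objects of a cocomplete category is a regular generator if any two distinct parallel arrows stay distinct after composition with some arrow out of an object in $S$, and every object is the coequalizer of two parallel arrows $f,g:y\to z$ with $y$ and $z$ coproducts of objects in $S$. A category is locally finitely presentable if it is cocomplete and there is a set of finitely presentable objects such that every object is a filtered colimit of objects in that set. **Theorem.** The category $\mathrm{CQG}$ is cocomplete; each $A_u(Q)$, for $Q\in GL_n(\mathbb C)$ positive, is a finitely presentable object of $\mathrm{CQG}$; the set of all $A_u(Q)$ (for all $n$ and $Q$) is a regular generator in $\mathrm{CQG}$; and $\mathrm{CQG}$ is locally finitely presentable. -/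

import Mathlib

open CategoryTheory CategoryTheory.Limits

universe u

/-! ### Hopf `*`-algebras and CQG algebras -/

namespace QuantumGroup

open scoped TensorProduct

/-- A complex Hopf algebra with a `*`-algebra structure (a conjugate linear involutive algebra
anti-automorphism) is a Hopf `*`-algebra if the comultiplication and the counit are morphisms of
`*`-algebras.  The involution of `H ⊗ H` is `(a ⊗ b)* = a* ⊗ b*`. -/
class IsHopfStarAlgebra (H : Type*) [Ring H] [HopfAlgebra ℂ H] [StarRing H] [StarModule ℂ H] :
    Prop where
  comul_star (a : H) : Coalgebra.comul (R := ℂ) (star a) = star (Coalgebra.comul (R := ℂ) a)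
  counit_star (a : H) : Coalgebra.counit (R := ℂ) (star a) = star (Coalgebra.counit (R := ℂ) a)

/-- `u = (u i j)` is the coefficient matrix of a finite-dimensional comodule: the map
`e j ↦ ∑ i, e i ⊗ u i j` is a (coassociative and counital) coaction of `H` on the vector space with
basis `e`. -/
structure IsCoefficientMatrix {H : Type*} [Ring H] [HopfAlgebra ℂ H] {ι : Type*} [Fintype ι]
    [DecidableEq ι] (u : Matrix ι ι H) : Prop where
  comul_apply (i j : ι) : Coalgebra.comul (R := ℂ) (u i j) = ∑ k, u i k ⊗ₜ[ℂ] u k j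
  counit_apply (i j : ι) : Coalgebra.counit (R := ℂ) (u i j) = (1 : Matrix ι ι ℂ) i j

/-- The set of all coefficients of unitary finite-dimensional comodules of a Hopf `*`-algebra: the
entries of the coefficient matrices (with respect to an orthonormal basis) that are unitary, i.e.
satisfy `u * u* = 1 = u* * u`, where `(u*) i j = (u j i)*`. -/
def unitaryCoefficients (H : Type*) [Ring H] [HopfAlgebra ℂ H] [StarRing H] : Set H :=
  {a | ∃ (n : ℕ) (u : Matrix (Fin n) (Fin n) H),
    IsCoefficientMatrix u ∧ u ∈ unitary (Matrix (Fin n) (Fin n) H) ∧ ∃ i j, u i j = a}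

end QuantumGroup

open QuantumGroup in
/-- A CQG algebra: a Hopf `*`-algebra that is the linear span of the coefficients of its unitary
finite-dimensional comodules. -/
structure CQG : Type (u + 1) where
  carrier : Type u
  [ring : Ring carrier]
  [hopfAlgebra : HopfAlgebra ℂ carrier]
  [starRing : StarRing carrier]
  [starModule : StarModule ℂ carrier]
  [isHopfStarAlgebra : IsHopfStarAlgebra carrier]
  span_unitaryCoefficients : Submodule.span ℂ (unitaryCoefficients carrier) = ⊤

namespace CQG

instance : CoeSort CQG.{u} (Type u) := ⟨CQG.carrier⟩

attribute [instance] CQG.ring CQG.hopfAlgebra CQG.starRing CQG.starModule CQG.isHopfStarAlgebra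

/-- Morphisms of Hopf `*`-algebras: unital algebra homomorphisms compatible with comultiplication,
counit and involution (such a map automatically commutes with the antipodes). -/
@[ext]
structure Hom (A B : CQG.{u}) : Type u where
  toBialgHom : A →ₐc[ℂ] B
  map_star (a : A) : toBialgHom (star a) = star (toBialgHom a)

/-- The category of CQG algebras. -/
instance : Category.{u} CQG.{u} where
  Hom := Hom
  id A := ⟨BialgHom.id ℂ A, fun _ => rfl⟩
  comp f g := ⟨g.toBialgHom.comp f.toBialgHom, fun a =>
    (congrArg g.toBialgHom (f.map_star a)).trans (g.map_star _)⟩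

end CQG

/-! ### The universal CQG algebras `A_u(Q)` -/

namespace QuantumGroup

open scoped TensorProduct ComplexOrder MatrixOrder
open Matrix

/-- Positive invertible operators on `ℂⁿ`. -/
def PosMatrix (n : ℕ) : Type := {Q : Matrix (Fin n) (Fin n) ℂ // Q.PosDef}

namespace PosMatrix

variable {n : ℕ} (Q : PosMatrix n)

/-- The positive square root `Q^{1/2}`. -/
noncomputable def root : Matrix (Fin n) (Fin n) ℂ := CFC.sqrt Q.1

theorem root_mul_root : Q.root * Q.root = Q.1 :=
  CFC.sqrt_mul_sqrt_self Q.1 Q.2.posSemidef.nonneg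

theorem root_conjTranspose : Q.rootᴴ = Q.root :=
  (CFC.sqrt_nonneg Q.1).posSemidef.1

theorem isUnit_det_root : IsUnit Q.root.det := by
  have h : IsUnit (Q.root * Q.root).det := by
    rw [root_mul_root]
    exact (Matrix.isUnit_iff_isUnit_det _).1 Q.2.isUnit
  rw [det_mul] at h
  exact isUnit_of_mul_isUnit_left h

theorem root_mul_inv : Q.root * Q.root⁻¹ = 1 := mul_nonsing_inv _ Q.isUnit_det_root

theorem inv_mul_root : Q.root⁻¹ * Q.root = 1 := nonsing_inv_mul _ Q.isUnit_det_root

theorem inv_conjTranspose : (Q.root⁻¹)ᴴ = Q.root⁻¹ := by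
  rw [conjTranspose_nonsing_inv, root_conjTranspose]

end PosMatrix

/-- A complex matrix, viewed as a matrix over a complex algebra. -/
def scalarMat (B : Type*) [Ring B] [Algebra ℂ B] {n : ℕ} (M : Matrix (Fin n) (Fin n) ℂ) :
    Matrix (Fin n) (Fin n) B := M.map (algebraMap ℂ B)

section scalarMat

variable (B : Type*) [Ring B] [Algebra ℂ B] {n : ℕ} (M N : Matrix (Fin n) (Fin n) ℂ)

@[simp] theorem scalarMat_apply (i j : Fin n) : scalarMat B M i j = algebraMap ℂ B (M i j) := rfl

theorem scalarMat_mul : scalarMat B (M * N) = scalarMat B M * scalarMat B N :=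
  Matrix.map_mul

@[simp] theorem scalarMat_one : scalarMat B (1 : Matrix (Fin n) (Fin n) ℂ) = 1 := by
  simp [scalarMat]

variable {B}

theorem scalarMat_map {C : Type*} [Ring C] [Algebra ℂ C] (f : B →ₐ[ℂ] C) :
    (scalarMat B M).map f = scalarMat C M := by
  ext i j; simp

theorem transpose_scalarMat_mul (X : Matrix (Fin n) (Fin n) B) :
    (scalarMat B M * X)ᵀ = Xᵀ * scalarMat B Mᵀ := by
  ext i j; simp [Matrix.mul_apply, Algebra.commutes]

theorem transpose_mul_scalarMat (X : Matrix (Fin n) (Fin n) B) :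
    (X * scalarMat B M)ᵀ = scalarMat B Mᵀ * Xᵀ := by
  ext i j; simp [Matrix.mul_apply, Algebra.commutes]

end scalarMat

section twist

variable {n : ℕ} (Q : PosMatrix n) {B : Type*} [Ring B] [Algebra ℂ B]
  (v w : Matrix (Fin n) (Fin n) B)

/-- The matrix `Q^{1/2} w Q^{-1/2}`. -/
noncomputable def twist : Matrix (Fin n) (Fin n) B :=
  scalarMat B Q.root * w * scalarMat B Q.root⁻¹

/-- The matrix `Q^{-1/2} vᵀ Q^{1/2}`.  As `Q^{1/2}` is self-adjoint, this is the adjoint of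
`Q^{1/2} v̄ Q^{-1/2}`, where `v̄ = ((v i j)*)`. -/
noncomputable def twistAdj : Matrix (Fin n) (Fin n) B :=
  scalarMat B Q.root⁻¹ * vᵀ * scalarMat B Q.root

variable {C : Type*} [Ring C] [Algebra ℂ C] (f : B →ₐ[ℂ] C)

theorem twist_map : (twist Q w).map f = twist Q (w.map f) := by
  simp [twist, Matrix.map_mul, scalarMat_map]

theorem twistAdj_map : (twistAdj Q v).map f = twistAdj Q (v.map f) := by
  simp [twistAdj, Matrix.map_mul, scalarMat_map, Matrix.transpose_map]

end twist

/-- The defining relations of `A_u(Q)`, for a matrix `v = (v i j)` and a matrix `w = (w i j)` that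
plays the role of `v̄ = ((v i j)*)`, so that `wᵀ` plays the role of the adjoint of `v`: both `v` and
`Q^{1/2} w Q^{-1/2}` are unitary. -/
structure AuRelations {n : ℕ} (Q : PosMatrix n) {B : Type*} [Ring B] [Algebra ℂ B]
    (v w : Matrix (Fin n) (Fin n) B) : Prop where
  mul_adjoint : v * wᵀ = 1
  adjoint_mul : wᵀ * v = 1
  twist_mul_adjoint : twist Q w * twistAdj Q v = 1
  adjoint_mul_twist : twistAdj Q v * twist Q w = 1

/-- The generators of `A_u(Q)` as a complex algebra: `u i j` and its adjoint `(u i j)*`. -/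
inductive AuGenerator (n : ℕ) : Type u
  | gen (i j : Fin n)
  | genStar (i j : Fin n)

/-- The generic matrix `u`. -/
noncomputable def freeMat (n : ℕ) : Matrix (Fin n) (Fin n) (FreeAlgebra ℂ (AuGenerator.{u} n)) :=
  fun i j => FreeAlgebra.ι ℂ (.gen i j)

/-- The generic matrix `ū`. -/
noncomputable def freeMatStar (n : ℕ) :
    Matrix (Fin n) (Fin n) (FreeAlgebra ℂ (AuGenerator.{u} n)) :=
  fun i j => FreeAlgebra.ι ℂ (.genStar i j)

/-- The relations `AuRelations Q u ū`, imposed entrywise on the free algebra. -/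
inductive AuRel {n : ℕ} (Q : PosMatrix n) :
    FreeAlgebra ℂ (AuGenerator.{u} n) → FreeAlgebra ℂ (AuGenerator.{u} n) → Prop
  | mul_adjoint (i j : Fin n) :
      AuRel Q ((freeMat n * (freeMatStar n)ᵀ) i j) (if i = j then 1 else 0)
  | adjoint_mul (i j : Fin n) :
      AuRel Q (((freeMatStar n)ᵀ * freeMat n) i j) (if i = j then 1 else 0)
  | twist_mul_adjoint (i j : Fin n) :
      AuRel Q ((twist Q (freeMatStar n) * twistAdj Q (freeMat n)) i j) (if i = j then 1 else 0)
  | adjoint_mul_twist (i j : Fin n) :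
      AuRel Q ((twistAdj Q (freeMat n) * twist Q (freeMatStar n)) i j) (if i = j then 1 else 0)

/-- The complex algebra `A_u(Q)`: the `*`-algebra generated by the entries of `u`, subject to the
relations making `u` and `Q^{1/2} ū Q^{-1/2}` unitary. -/
def AuAlgebra {n : ℕ} (Q : PosMatrix n) : Type u := RingQuot (AuRel.{u} Q)

namespace AuAlgebra

variable {n : ℕ} (Q : PosMatrix n)

noncomputable instance : Ring (AuAlgebra.{u} Q) := inferInstanceAs (Ring (RingQuot (AuRel.{u} Q)))

noncomputable instance : Algebra ℂ (AuAlgebra.{u} Q) :=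
  inferInstanceAs (Algebra ℂ (RingQuot (AuRel.{u} Q)))

/-- The quotient map. -/
noncomputable def mk : FreeAlgebra ℂ (AuGenerator.{u} n) →ₐ[ℂ] AuAlgebra.{u} Q :=
  RingQuot.mkAlgHom ℂ (AuRel.{u} Q)

/-- The matrix `u` of standard generators. -/
noncomputable def std : Matrix (Fin n) (Fin n) (AuAlgebra.{u} Q) := (freeMat n).map (mk Q)

/-- The matrix `ū` of adjoints of the standard generators. -/
noncomputable def stdStar : Matrix (Fin n) (Fin n) (AuAlgebra.{u} Q) := (freeMatStar n).map (mk Q)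

end AuAlgebra

section relations

variable {n : ℕ} {Q : PosMatrix n} {B : Type*} [Ring B] [Algebra ℂ B]

theorem AuRelations.map {C : Type*} [Ring C] [Algebra ℂ C] {v w : Matrix (Fin n) (Fin n) B}
    (h : AuRelations Q v w) (f : B →ₐ[ℂ] C) : AuRelations Q (v.map f) (w.map f) where
  mul_adjoint := by
    simpa [Matrix.map_mul, Matrix.transpose_map, twist_map, twistAdj_map] using
      congrArg (fun X => X.map f) h.mul_adjoint
  adjoint_mul := by
    simpa [Matrix.map_mul, Matrix.transpose_map, twist_map, twistAdj_map] using
      congrArg (fun X => X.map f) h.adjoint_mul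
  twist_mul_adjoint := by
    simpa [Matrix.map_mul, Matrix.transpose_map, twist_map, twistAdj_map] using
      congrArg (fun X => X.map f) h.twist_mul_adjoint
  adjoint_mul_twist := by
    simpa [Matrix.map_mul, Matrix.transpose_map, twist_map, twistAdj_map] using
      congrArg (fun X => X.map f) h.adjoint_mul_twist

theorem scalar_root_inv : scalarMat B Q.root * scalarMat B Q.root⁻¹ = 1 := by
  rw [← scalarMat_mul, Q.root_mul_inv, scalarMat_one]

theorem scalar_inv_root : scalarMat B Q.root⁻¹ * scalarMat B Q.root = 1 := by
  rw [← scalarMat_mul, Q.inv_mul_root, scalarMat_one]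

theorem AuRelations.rel₃ {v w : Matrix (Fin n) (Fin n) B} (h : AuRelations Q v w) :
    w * (scalarMat B Q.root⁻¹ * scalarMat B Q.root⁻¹) * vᵀ =
      scalarMat B Q.root⁻¹ * scalarMat B Q.root⁻¹ := by
  have h3 := h.twist_mul_adjoint
  rw [twist, twistAdj] at h3
  have e1 := scalar_root_inv (Q := Q) (B := B)
  have e2 := scalar_inv_root (Q := Q) (B := B)
  set s := scalarMat B Q.root
  set t := scalarMat B Q.root⁻¹
  calc w * (t * t) * vᵀ = (t * s) * (w * (t * t) * vᵀ) * (s * t) := by rw [e1, e2]; simp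
    _ = t * ((s * w * t) * (t * vᵀ * s)) * t := by simp only [mul_assoc]
    _ = t * t := by rw [h3]; simp

theorem AuRelations.rel₄ {v w : Matrix (Fin n) (Fin n) B} (h : AuRelations Q v w) :
    vᵀ * (scalarMat B Q.root * scalarMat B Q.root) * w =
      scalarMat B Q.root * scalarMat B Q.root := by
  have h3 := h.adjoint_mul_twist
  rw [twist, twistAdj] at h3
  have e1 := scalar_root_inv (Q := Q) (B := B)
  have e2 := scalar_inv_root (Q := Q) (B := B)
  set s := scalarMat B Q.root
  set t := scalarMat B Q.root⁻¹
  calc vᵀ * (s * s) * w = (s * t) * (vᵀ * (s * s) * w) * (t * s) := by rw [e1, e2]; simp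
    _ = s * ((t * vᵀ * s) * (s * w * t)) * s := by simp only [mul_assoc]
    _ = s * s := by rw [h3]; simp

theorem AuRelations.of_rel {v w : Matrix (Fin n) (Fin n) B} (h1 : v * wᵀ = 1) (h2 : wᵀ * v = 1)
    (h3 : w * (scalarMat B Q.root⁻¹ * scalarMat B Q.root⁻¹) * vᵀ =
      scalarMat B Q.root⁻¹ * scalarMat B Q.root⁻¹)
    (h4 : vᵀ * (scalarMat B Q.root * scalarMat B Q.root) * w =
      scalarMat B Q.root * scalarMat B Q.root) : AuRelations Q v w := by
  have e1 := scalar_root_inv (Q := Q) (B := B)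
  have e2 := scalar_inv_root (Q := Q) (B := B)
  refine ⟨h1, h2, ?_, ?_⟩ <;> rw [twist, twistAdj]
  · set s := scalarMat B Q.root
    set t := scalarMat B Q.root⁻¹
    calc (s * w * t) * (t * vᵀ * s) = s * (w * (t * t) * vᵀ) * s := by simp only [mul_assoc]
      _ = (s * t) * (t * s) := by rw [h3]; simp only [mul_assoc]
      _ = 1 := by rw [e1, e2, one_mul]
  · set s := scalarMat B Q.root
    set t := scalarMat B Q.root⁻¹
    calc (t * vᵀ * s) * (s * w * t) = t * (vᵀ * (s * s) * w) * t := by simp only [mul_assoc]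
      _ = (t * s) * (s * t) := by rw [h4]; simp only [mul_assoc]
      _ = 1 := by rw [e1, e2, one_mul]

end relations

namespace AuAlgebra

variable {n : ℕ} (Q : PosMatrix n)

theorem std_relations : AuRelations Q (std.{u} Q) (stdStar Q) := by
  have key {M : Matrix (Fin n) (Fin n) (FreeAlgebra ℂ (AuGenerator.{u} n))}
      (h : ∀ i j, AuRel Q (M i j) (if i = j then 1 else 0)) : M.map (mk Q) = 1 := by
    ext i j
    have := RingQuot.mkAlgHom_rel ℂ (h i j)
    change mk Q _ = mk Q _ at this
    rw [Matrix.map_apply, this, Matrix.one_apply]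
    split_ifs <;> simp
  constructor
  · simpa [Matrix.map_mul, Matrix.transpose_map, twist_map, twistAdj_map, std, stdStar] using
      key AuRel.mul_adjoint
  · simpa [Matrix.map_mul, Matrix.transpose_map, twist_map, twistAdj_map, std, stdStar] using
      key AuRel.adjoint_mul
  · simpa [Matrix.map_mul, Matrix.transpose_map, twist_map, twistAdj_map, std, stdStar] using
      key AuRel.twist_mul_adjoint
  · simpa [Matrix.map_mul, Matrix.transpose_map, twist_map, twistAdj_map, std, stdStar] using
      key AuRel.adjoint_mul_twist

section lift

variable {Q} {B : Type*} [Ring B] [Algebra ℂ B] {v w : Matrix (Fin n) (Fin n) B}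

/-- The map out of the free algebra given by the images of the generators. -/
noncomputable def freeLift (v w : Matrix (Fin n) (Fin n) B) :
    FreeAlgebra ℂ (AuGenerator.{u} n) →ₐ[ℂ] B :=
  FreeAlgebra.lift ℂ (fun x => match x with
    | .gen i j => v i j
    | .genStar i j => w i j)

theorem freeMat_map : (freeMat.{u} n).map (freeLift v w) = v := by
  ext i j; simp [freeMat, freeLift]

theorem freeMatStar_map : (freeMatStar.{u} n).map (freeLift v w) = w := by
  ext i j; simp [freeMatStar, freeLift]

theorem freeLift_eq {M : Matrix (Fin n) (Fin n) (FreeAlgebra ℂ (AuGenerator.{u} n))}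
    (h : M.map (freeLift v w) = 1) (i j : Fin n) :
    freeLift v w (M i j) = freeLift v w (if i = j then 1 else 0) := by
  rw [← Matrix.map_apply (f := freeLift v w), h, Matrix.one_apply]
  split_ifs <;> simp

/-- The algebra homomorphism out of `A_u(Q)` given by matrices satisfying the relations. -/
noncomputable def lift (h : AuRelations Q v w) : AuAlgebra.{u} Q →ₐ[ℂ] B :=
  RingQuot.liftAlgHom ℂ ⟨freeLift v w, by
    intro x y hxy
    cases hxy <;> apply freeLift_eq <;>
      simp [Matrix.map_mul, Matrix.transpose_map, twist_map, twistAdj_map, freeMat_map,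
        freeMatStar_map, h.mul_adjoint, h.adjoint_mul, h.twist_mul_adjoint, h.adjoint_mul_twist]⟩

theorem lift_mk (h : AuRelations Q v w) (x : FreeAlgebra ℂ (AuGenerator.{u} n)) :
    lift h (mk Q x) = freeLift v w x :=
  RingQuot.liftAlgHom_mkAlgHom_apply ℂ _ _ _

@[simp] theorem lift_std (h : AuRelations Q v w) (i j : Fin n) :
    lift h (std.{u} Q i j) = v i j := by
  simp [std, lift_mk, freeMat, freeLift]

@[simp] theorem lift_stdStar (h : AuRelations Q v w) (i j : Fin n) :
    lift h (stdStar.{u} Q i j) = w i j := by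
  simp [stdStar, lift_mk, freeMatStar, freeLift]

theorem algHom_ext {B : Type*} [Semiring B] [Algebra ℂ B] {f g : AuAlgebra.{u} Q →ₐ[ℂ] B}
    (h1 : ∀ i j, f (std Q i j) = g (std Q i j))
    (h2 : ∀ i j, f (stdStar Q i j) = g (stdStar Q i j)) : f = g := by
  refine RingQuot.ringQuot_ext' ℂ f g ?_
  ext x
  cases x with
  | gen i j => exact h1 i j
  | genStar i j => exact h2 i j

@[elab_as_elim]
theorem induction {p : AuAlgebra.{u} Q → Prop} (std : ∀ i j, p (std Q i j))
    (stdStar : ∀ i j, p (stdStar Q i j)) (alg : ∀ c, p (algebraMap ℂ _ c))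
    (add : ∀ a b, p a → p b → p (a + b)) (mul : ∀ a b, p a → p b → p (a * b)) (a) : p a := by
  obtain ⟨x, rfl⟩ := RingQuot.mkAlgHom_surjective ℂ (AuRel.{u} Q) a
  change p (mk Q x)
  induction x using FreeAlgebra.induction with
  | grade0 r => simpa using alg r
  | grade1 x =>
    cases x with
    | gen i j => exact std i j
    | genStar i j => exact stdStar i j
  | mul a b ha hb => rw [map_mul]; exact mul _ _ ha hb
  | add a b ha hb => rw [map_add]; exact add _ _ ha hb

end lift

/-! The involution of `A_u(Q)` -/

section op

open MulOpposite

variable (B : Type*) [Ring B] [Algebra ℂ B]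

/-- The opposite algebra with the complex conjugate scalar multiplication: algebra homomorphisms to
it are conjugate linear algebra anti-homomorphisms. -/
def ConjOp : Type _ := Bᵐᵒᵖ

instance : Ring (ConjOp B) := inferInstanceAs (Ring Bᵐᵒᵖ)

noncomputable instance : Algebra ℂ (ConjOp B) :=
  RingHom.toAlgebra' ((algebraMap ℂ Bᵐᵒᵖ).comp (starRingEnd ℂ))
    (fun c x => Algebra.commutes (A := Bᵐᵒᵖ) (starRingEnd ℂ c) x)

variable {B}

theorem algebraMap_conjOp (c : ℂ) :
    algebraMap ℂ (ConjOp B) c = op (algebraMap ℂ B (star c)) := rfl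

/-- The identity map to the conjugate opposite algebra, which reverses products. -/
def toConj (a : B) : ConjOp B := op a

/-- The inverse of `toConj`. -/
def ofConj (a : ConjOp B) : B := unop a

/-- Entrywise passage to the conjugate opposite algebra, combined with the transpose. -/
def conjMat (M : Matrix (Fin n) (Fin n) B) : Matrix (Fin n) (Fin n) (ConjOp B) := Mᵀ.map toConj

theorem conjMat_transpose {B : Type*} (M : Matrix (Fin n) (Fin n) B) : (conjMat M)ᵀ = conjMat Mᵀ := rfl

theorem conjMat_mul {B : Type*} [Ring B] (M N : Matrix (Fin n) (Fin n) B) : conjMat M * conjMat N = conjMat (N * M) := by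
  ext i j
  change ∑ k, toConj (M k i) * toConj (N j k) = toConj (∑ k, N j k * M k i)
  exact (Finset.op_sum _ _).symm

theorem conjMat_one {B : Type*} [Ring B] : conjMat (1 : Matrix (Fin n) (Fin n) B) = 1 := by
  ext i j
  rw [conjMat, Matrix.transpose_one, Matrix.map_apply, Matrix.one_apply, Matrix.one_apply]
  split_ifs <;> rfl

theorem conjMat_scalar (M : Matrix (Fin n) (Fin n) ℂ) :
    scalarMat (ConjOp B) M = conjMat (scalarMat B Mᴴ) := by
  ext i j
  rw [scalarMat_apply, algebraMap_conjOp]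
  rfl

theorem conjOp_relations {Q : PosMatrix n} {v w : Matrix (Fin n) (Fin n) B}
    (h : AuRelations Q v w) : AuRelations Q (conjMat wᵀ) (conjMat vᵀ) where
  mul_adjoint := by
    rw [conjMat_transpose, conjMat_mul, transpose_transpose, h.mul_adjoint, conjMat_one]
  adjoint_mul := by
    rw [conjMat_transpose, conjMat_mul, transpose_transpose, h.adjoint_mul, conjMat_one]
  twist_mul_adjoint := by
    rw [← conjMat_one, ← h.twist_mul_adjoint]
    simp only [twist, twistAdj, conjMat_scalar, Q.root_conjTranspose, Q.inv_conjTranspose,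
      conjMat_transpose, conjMat_mul, transpose_transpose, mul_assoc]
  adjoint_mul_twist := by
    rw [← conjMat_one, ← h.adjoint_mul_twist]
    simp only [twist, twistAdj, conjMat_scalar, Q.root_conjTranspose, Q.inv_conjTranspose,
      conjMat_transpose, conjMat_mul, transpose_transpose, mul_assoc]

end op

/-- The involution, as an algebra homomorphism to the conjugate opposite algebra. -/
noncomputable def starHom : AuAlgebra.{u} Q →ₐ[ℂ] ConjOp (AuAlgebra.{u} Q) :=
  lift (conjOp_relations (std_relations Q))

/-- The involution of `A_u(Q)` exchanges `u i j` and `(u i j)*`. -/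
noncomputable instance : Star (AuAlgebra.{u} Q) := ⟨fun a => ofConj (starHom Q a)⟩

theorem star_def (a : AuAlgebra.{u} Q) : star a = ofConj (starHom Q a) := rfl

@[simp] theorem star_std (i j : Fin n) : star (std.{u} Q i j) = stdStar Q i j := by
  rw [star_def, starHom, lift_std]; rfl

@[simp] theorem star_stdStar (i j : Fin n) : star (stdStar.{u} Q i j) = std Q i j := by
  rw [star_def, starHom, lift_stdStar]; rfl

theorem star_algebraMap' (c : ℂ) :
    star (algebraMap ℂ (AuAlgebra.{u} Q) c) = algebraMap ℂ _ (star c) := by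
  rw [star_def, AlgHom.commutes]; rfl

theorem star_mul' (a b : AuAlgebra.{u} Q) : star (a * b) = star b * star a := by
  rw [star_def, map_mul]; rfl

theorem star_add' (a b : AuAlgebra.{u} Q) : star (a + b) = star a + star b := by
  rw [star_def, map_add]; rfl

noncomputable instance : StarRing (AuAlgebra.{u} Q) where
  star_involutive a := by
    induction a using AuAlgebra.induction with
    | std i j => simp
    | stdStar i j => simp
    | alg c => simp [star_algebraMap']
    | add a b ha hb => rw [star_add', star_add', ha, hb]
    | mul a b ha hb => rw [star_mul', star_mul', ha, hb]
  star_mul := star_mul' Q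
  star_add := star_add' Q

instance : StarModule ℂ (AuAlgebra.{u} Q) where
  star_smul c a := by
    rw [Algebra.smul_def, star_mul', star_algebraMap', Algebra.smul_def, Algebra.commutes]

/-! The bialgebra structure of `A_u(Q)` -/

section comul

variable {Q} {B : Type*} [Ring B] [Algebra ℂ B]

theorem mul_relations {v w v' w' : Matrix (Fin n) (Fin n) B} (h : AuRelations Q v w)
    (h' : AuRelations Q v' w') (hv : ∀ i j k l, Commute (v i j) (v' k l))
    (hw : ∀ i j k l, Commute (w i j) (w' k l)) : AuRelations Q (v * v') (w * w') := by
  have tv : (v * v')ᵀ = v'ᵀ * vᵀ := by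
    ext i j
    simp only [Matrix.transpose_apply, Matrix.mul_apply, (hv _ _ _ _).eq]
  have tw : (w * w')ᵀ = w'ᵀ * wᵀ := by
    ext i j
    simp only [Matrix.transpose_apply, Matrix.mul_apply, (hw _ _ _ _).eq]
  apply AuRelations.of_rel
  · rw [tw, mul_assoc, ← mul_assoc v', h'.mul_adjoint, one_mul, h.mul_adjoint]
  · rw [tw, mul_assoc, ← mul_assoc wᵀ, h.adjoint_mul, one_mul, h'.adjoint_mul]
  · rw [tv]
    calc _ = w * (w' * (scalarMat B Q.root⁻¹ * scalarMat B Q.root⁻¹) * v'ᵀ) * vᵀ := by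
          simp only [mul_assoc]
      _ = _ := by rw [h'.rel₃, h.rel₃]
  · rw [tv]
    calc _ = v'ᵀ * (vᵀ * (scalarMat B Q.root * scalarMat B Q.root) * w) * w' := by
          simp only [mul_assoc]
      _ = _ := by rw [h.rel₄, h'.rel₄]

end comul

theorem one_relations : AuRelations Q (1 : Matrix (Fin n) (Fin n) ℂ) 1 := by
  apply AuRelations.of_rel <;> simp

/-- The comultiplication `u i j ↦ ∑ k, u i k ⊗ u k j`. -/
noncomputable def comulHom : AuAlgebra.{u} Q →ₐ[ℂ] AuAlgebra.{u} Q ⊗[ℂ] AuAlgebra.{u} Q :=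
  lift (mul_relations ((std_relations Q).map Algebra.TensorProduct.includeLeft)
    ((std_relations Q).map Algebra.TensorProduct.includeRight)
    (fun i j k l => by simp [Commute, SemiconjBy])
    (fun i j k l => by simp [Commute, SemiconjBy]))

/-- The counit `u i j ↦ δ i j`. -/
noncomputable def counitHom : AuAlgebra.{u} Q →ₐ[ℂ] ℂ := lift (one_relations Q)

theorem comulHom_std (i j : Fin n) :
    comulHom Q (std.{u} Q i j) = ∑ k, std Q i k ⊗ₜ[ℂ] std Q k j := by
  simp [comulHom, Matrix.mul_apply]

theorem comulHom_stdStar (i j : Fin n) :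
    comulHom Q (stdStar.{u} Q i j) = ∑ k, stdStar Q i k ⊗ₜ[ℂ] stdStar Q k j := by
  simp [comulHom, Matrix.mul_apply]

theorem counitHom_std (i j : Fin n) :
    counitHom Q (std.{u} Q i j) = (1 : Matrix (Fin n) (Fin n) ℂ) i j := by
  simp [counitHom]

theorem counitHom_stdStar (i j : Fin n) :
    counitHom Q (stdStar.{u} Q i j) = (1 : Matrix (Fin n) (Fin n) ℂ) i j := by
  simp [counitHom]

noncomputable instance : Bialgebra ℂ (AuAlgebra.{u} Q) :=
  Bialgebra.ofAlgHom (comulHom Q) (counitHom Q)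
    (by
      apply algHom_ext <;> intro i j
      · simp only [AlgHom.comp_apply, comulHom_std, map_sum, Algebra.TensorProduct.map_tmul,
          TensorProduct.sum_tmul, TensorProduct.tmul_sum, AlgHom.coe_id, id]
        rw [Finset.sum_comm]
        rfl
      · simp only [AlgHom.comp_apply, comulHom_stdStar, map_sum, Algebra.TensorProduct.map_tmul,
          TensorProduct.sum_tmul, TensorProduct.tmul_sum, AlgHom.coe_id, id]
        rw [Finset.sum_comm]
        rfl)
    (by
      apply algHom_ext <;> intro i j
      · simp [comulHom_std, counitHom_std, Matrix.one_apply, TensorProduct.ite_tmul]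
      · simp [comulHom_stdStar, counitHom_stdStar, Matrix.one_apply, TensorProduct.ite_tmul])
    (by
      apply algHom_ext <;> intro i j
      · simp [comulHom_std, counitHom_std, Matrix.one_apply, TensorProduct.tmul_ite]
      · simp [comulHom_stdStar, counitHom_stdStar, Matrix.one_apply, TensorProduct.tmul_ite])

theorem comul_std (i j : Fin n) :
    Coalgebra.comul (R := ℂ) (std.{u} Q i j) = ∑ k, std Q i k ⊗ₜ[ℂ] std Q k j :=
  comulHom_std Q i j

theorem comul_stdStar (i j : Fin n) :
    Coalgebra.comul (R := ℂ) (stdStar.{u} Q i j) = ∑ k, stdStar Q i k ⊗ₜ[ℂ] stdStar Q k j :=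
  comulHom_stdStar Q i j

theorem counit_std (i j : Fin n) :
    Coalgebra.counit (R := ℂ) (std.{u} Q i j) = (1 : Matrix (Fin n) (Fin n) ℂ) i j :=
  counitHom_std Q i j

theorem counit_stdStar (i j : Fin n) :
    Coalgebra.counit (R := ℂ) (stdStar.{u} Q i j) = (1 : Matrix (Fin n) (Fin n) ℂ) i j :=
  counitHom_stdStar Q i j

/-! The antipode of `A_u(Q)` -/

section antipode

open MulOpposite

/-- Entrywise passage to the opposite algebra, combined with the transpose. -/
def opMat {B : Type*} (M : Matrix (Fin n) (Fin n) B) : Matrix (Fin n) (Fin n) Bᵐᵒᵖ := Mᵀ.map op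

theorem opMat_transpose {B : Type*} (M : Matrix (Fin n) (Fin n) B) : (opMat M)ᵀ = opMat Mᵀ := rfl

theorem opMat_mul {B : Type*} [Ring B] (M N : Matrix (Fin n) (Fin n) B) :
    opMat M * opMat N = opMat (N * M) := by
  ext i j
  simp [opMat, Matrix.mul_apply]

theorem opMat_one {B : Type*} [Ring B] : opMat (1 : Matrix (Fin n) (Fin n) B) = 1 := by
  simp [opMat]

theorem opMat_scalar {B : Type*} [Ring B] [Algebra ℂ B] (M : Matrix (Fin n) (Fin n) ℂ) :
    scalarMat Bᵐᵒᵖ M = opMat (scalarMat B Mᵀ) := by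
  ext i j; simp [opMat, MulOpposite.algebraMap_apply]

/-- The matrix `Q⁻¹ uᵀ Q`, whose entries are the images of the `(u i j)*` under the antipode. -/
noncomputable def antiStar : Matrix (Fin n) (Fin n) (AuAlgebra.{u} Q) :=
  scalarMat _ (Q.root⁻¹ * Q.root⁻¹) * (std Q)ᵀ * scalarMat _ (Q.root * Q.root)

theorem scalar_inv_mul (B : Type*) [Ring B] [Algebra ℂ B] :
    scalarMat B (Q.root⁻¹ * Q.root⁻¹) * scalarMat B (Q.root * Q.root) = 1 := by
  rw [← scalarMat_mul, mul_assoc, ← mul_assoc _ Q.root, Q.inv_mul_root, one_mul, Q.inv_mul_root,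
    scalarMat_one]

theorem scalar_inv_mul_transpose (B : Type*) [Ring B] [Algebra ℂ B] :
    scalarMat B (Q.root⁻¹ * Q.root⁻¹)ᵀ * scalarMat B (Q.root * Q.root)ᵀ = 1 := by
  rw [← scalarMat_mul, ← transpose_mul, mul_assoc, ← mul_assoc _ Q.root⁻¹, Q.root_mul_inv, one_mul,
    Q.root_mul_inv, transpose_one, scalarMat_one]

theorem antiStar_mul : antiStar.{u} Q * stdStar Q = 1 := by
  have h := (std_relations.{u} Q).rel₄
  rw [← scalarMat_mul] at h
  rw [antiStar, mul_assoc, mul_assoc, ← mul_assoc (std Q)ᵀ, h, scalar_inv_mul]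

theorem stdStar_mul_antiStar : stdStar.{u} Q * antiStar Q = 1 := by
  have h := (std_relations.{u} Q).rel₃
  rw [← scalarMat_mul] at h
  rw [antiStar, ← mul_assoc, ← mul_assoc, h, scalar_inv_mul]

theorem antiStar_transpose : (antiStar.{u} Q)ᵀ =
    scalarMat _ (Q.root * Q.root)ᵀ * std Q * scalarMat _ (Q.root⁻¹ * Q.root⁻¹)ᵀ := by
  rw [antiStar, transpose_mul_scalarMat, transpose_scalarMat_mul, transpose_transpose, mul_assoc]

theorem antipode_relations :
    AuRelations Q (opMat (stdStar.{u} Q)) (opMat (antiStar.{u} Q)ᵀ) := by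
  apply AuRelations.of_rel
  · rw [opMat_transpose, transpose_transpose, opMat_mul, antiStar_mul, opMat_one]
  · rw [opMat_transpose, transpose_transpose, opMat_mul, stdStar_mul_antiStar, opMat_one]
  · rw [← scalarMat_mul, opMat_scalar, opMat_transpose, opMat_mul, opMat_mul, antiStar_transpose]
    congr 1
    rw [mul_assoc (scalarMat _ _) (std Q), ← mul_assoc (scalarMat _ (Q.root⁻¹ * Q.root⁻¹)ᵀ),
      scalar_inv_mul_transpose, one_mul, ← mul_assoc, (std_relations Q).adjoint_mul, one_mul]
  · rw [← scalarMat_mul, opMat_scalar, opMat_transpose, opMat_mul, opMat_mul, antiStar_transpose]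
    congr 1
    rw [mul_assoc, ← mul_assoc (scalarMat _ (Q.root⁻¹ * Q.root⁻¹)ᵀ), scalar_inv_mul_transpose,
      one_mul, mul_assoc, (std_relations Q).mul_adjoint, mul_one]

/-- The antipode, as an algebra homomorphism to the opposite algebra. -/
noncomputable def antipodeHom : AuAlgebra.{u} Q →ₐ[ℂ] (AuAlgebra.{u} Q)ᵐᵒᵖ :=
  lift (antipode_relations Q)

/-- The antipode `u i j ↦ (u j i)*`. -/
noncomputable def antipodeLin : AuAlgebra.{u} Q →ₗ[ℂ] AuAlgebra.{u} Q :=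
  (opLinearEquiv ℂ).symm.toLinearMap ∘ₗ (antipodeHom Q).toLinearMap

theorem antipodeLin_std (i j : Fin n) : antipodeLin Q (std.{u} Q i j) = stdStar Q j i := by
  simp [antipodeLin, antipodeHom, opMat]

theorem antipodeLin_stdStar (i j : Fin n) :
    antipodeLin Q (stdStar.{u} Q i j) = antiStar Q i j := by
  simp [antipodeLin, antipodeHom, opMat]

theorem antipodeLin_mul (a b : AuAlgebra.{u} Q) :
    antipodeLin Q (a * b) = antipodeLin Q b * antipodeLin Q a := by
  simp [antipodeLin]

theorem antipodeLin_algebraMap (c : ℂ) :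
    antipodeLin Q (algebraMap ℂ (AuAlgebra.{u} Q) c) = algebraMap ℂ _ c := by
  simp [antipodeLin, MulOpposite.algebraMap_apply]

theorem antipodeLin_one : antipodeLin Q (1 : AuAlgebra.{u} Q) = 1 := by
  simpa using antipodeLin_algebraMap Q 1

end antipode

open Coalgebra in
theorem antipode_left_mul {H : Type*} [Ring H] [Bialgebra ℂ H] (S : H →ₗ[ℂ] H)
    (hS : ∀ a b, S (a * b) = S b * S a) {a b : H}
    (ha : LinearMap.mul' ℂ H (S.rTensor H (comul a)) = algebraMap ℂ H (counit a))
    (hb : LinearMap.mul' ℂ H (S.rTensor H (comul b)) = algebraMap ℂ H (counit b)) :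
    LinearMap.mul' ℂ H (S.rTensor H (comul (a * b))) = algebraMap ℂ H (counit (a * b)) := by
  have key (x y : H ⊗[ℂ] H) (c : ℂ) (hx : LinearMap.mul' ℂ H (S.rTensor H x) = algebraMap ℂ H c) :
      LinearMap.mul' ℂ H (S.rTensor H (x * y)) = c • LinearMap.mul' ℂ H (S.rTensor H y) := by
    induction y with
    | zero => simp
    | add y z hy hz => rw [mul_add, map_add, map_add, hy, hz, map_add, map_add, smul_add]
    | tmul p q =>
      have h2 : LinearMap.mul' ℂ H (S.rTensor H (x * p ⊗ₜ[ℂ] q)) =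
          S p * LinearMap.mul' ℂ H (S.rTensor H x) * q := by
        clear hx
        induction x with
        | zero => simp
        | add x z hy hz => simp only [add_mul, map_add, hy, hz, mul_add]
        | tmul r t => simp [hS, mul_assoc]
      rw [h2, hx, ← Algebra.commutes, mul_assoc, ← Algebra.smul_def]
      simp
  rw [Bialgebra.comul_mul, key _ _ _ ha, hb, Bialgebra.counit_mul, map_mul, Algebra.smul_def]

open Coalgebra in
theorem antipode_right_mul {H : Type*} [Ring H] [Bialgebra ℂ H] (S : H →ₗ[ℂ] H)
    (hS : ∀ a b, S (a * b) = S b * S a) {a b : H}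
    (ha : LinearMap.mul' ℂ H (S.lTensor H (comul a)) = algebraMap ℂ H (counit a))
    (hb : LinearMap.mul' ℂ H (S.lTensor H (comul b)) = algebraMap ℂ H (counit b)) :
    LinearMap.mul' ℂ H (S.lTensor H (comul (a * b))) = algebraMap ℂ H (counit (a * b)) := by
  have key (x y : H ⊗[ℂ] H) (c : ℂ) (hy : LinearMap.mul' ℂ H (S.lTensor H y) = algebraMap ℂ H c) :
      LinearMap.mul' ℂ H (S.lTensor H (x * y)) = c • LinearMap.mul' ℂ H (S.lTensor H x) := by
    induction x with
    | zero => simp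
    | add x z hx hz => rw [add_mul, map_add, map_add, hx, hz, map_add, map_add, smul_add]
    | tmul p q =>
      have h2 : LinearMap.mul' ℂ H (S.lTensor H (p ⊗ₜ[ℂ] q * y)) =
          p * LinearMap.mul' ℂ H (S.lTensor H y) * S q := by
        clear hy
        induction y with
        | zero => simp
        | add x z hy hz => simp only [add_mul, map_add, hy, hz, mul_add]
        | tmul r t => simp [hS, mul_assoc]
      rw [h2, hy, ← Algebra.commutes, mul_assoc, ← Algebra.smul_def]
      simp
  rw [Bialgebra.comul_mul, key _ _ _ hb, ha, Bialgebra.counit_mul, map_mul, Algebra.smul_def,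
    Algebra.commutes]

noncomputable instance : HopfAlgebra ℂ (AuAlgebra.{u} Q) where
  antipode := antipodeLin Q
  mul_antipode_rTensor_comul := by
    ext a
    change LinearMap.mul' ℂ _ ((antipodeLin Q).rTensor _ (Coalgebra.comul a)) =
      algebraMap ℂ _ (Coalgebra.counit a)
    induction a using AuAlgebra.induction with
    | std i j =>
      have h := congrFun (congrFun (std_relations Q).adjoint_mul i) j
      simpa [comul_std, counit_std, antipodeLin_std, Matrix.mul_apply, Matrix.one_apply,
        apply_ite (algebraMap ℂ (AuAlgebra.{u} Q))] using h
    | stdStar i j =>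
      have h := congrFun (congrFun (antiStar_mul Q) i) j
      simpa [comul_stdStar, counit_stdStar, antipodeLin_stdStar, Matrix.mul_apply, Matrix.one_apply,
        apply_ite (algebraMap ℂ (AuAlgebra.{u} Q))] using h
    | alg c => simp [antipodeLin_algebraMap, Algebra.TensorProduct.algebraMap_apply]
    | add a b ha hb => simp only [map_add, ha, hb]
    | mul a b ha hb => exact antipode_left_mul _ (antipodeLin_mul Q) ha hb
  mul_antipode_lTensor_comul := by
    ext a
    change LinearMap.mul' ℂ _ ((antipodeLin Q).lTensor _ (Coalgebra.comul a)) =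
      algebraMap ℂ _ (Coalgebra.counit a)
    induction a using AuAlgebra.induction with
    | std i j =>
      have h := congrFun (congrFun (std_relations Q).mul_adjoint i) j
      simpa [comul_std, counit_std, antipodeLin_std, Matrix.mul_apply, Matrix.one_apply,
        apply_ite (algebraMap ℂ (AuAlgebra.{u} Q))] using h
    | stdStar i j =>
      have h := congrFun (congrFun (stdStar_mul_antiStar Q) i) j
      simpa [comul_stdStar, counit_stdStar, antipodeLin_stdStar, Matrix.mul_apply, Matrix.one_apply,
        apply_ite (algebraMap ℂ (AuAlgebra.{u} Q))] using h
    | alg c => simp [antipodeLin_one, Algebra.TensorProduct.algebraMap_apply]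
    | add a b ha hb => simp only [map_add, ha, hb]
    | mul a b ha hb => exact antipode_right_mul _ (antipodeLin_mul Q) ha hb

instance : IsHopfStarAlgebra (AuAlgebra.{u} Q) where
  comul_star a := by
    induction a using AuAlgebra.induction with
    | std i j => simp [comul_std, comul_stdStar, star_sum]
    | stdStar i j => simp [comul_std, comul_stdStar, star_sum]
    | alg c => simp [star_algebraMap', Algebra.TensorProduct.algebraMap_apply]
    | add a b ha hb => simp only [map_add, star_add, ha, hb]
    | mul a b ha hb => simp only [star_mul, Bialgebra.comul_mul, ha, hb]
  counit_star a := by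
    induction a using AuAlgebra.induction with
    | std i j => simp [counit_std, counit_stdStar, Matrix.one_apply]
    | stdStar i j => simp [counit_std, counit_stdStar, Matrix.one_apply]
    | alg c => simp [star_algebraMap']
    | add a b ha hb => simp only [map_add, star_add, ha, hb]
    | mul a b ha hb => simp only [star_mul, Bialgebra.counit_mul, ha, hb]

end AuAlgebra

/-! `A_u(Q)` is a CQG algebra -/

section coefficients

variable {H : Type*} [Ring H] [HopfAlgebra ℂ H] [StarRing H]

theorem mem_unitaryCoefficients {ι : Type*} [Fintype ι] [DecidableEq ι] {x : Matrix ι ι H}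
    (hx : IsCoefficientMatrix x) (hx' : x ∈ unitary (Matrix ι ι H)) (i j : ι) :
    x i j ∈ unitaryCoefficients H := by
  let e := (Fintype.equivFin ι).symm
  refine ⟨Fintype.card ι, x.submatrix e e, ⟨fun i j => ?_, fun i j => ?_⟩, ?_,
    e.symm i, e.symm j, by simp⟩
  · rw [submatrix_apply, hx.comul_apply, ← e.sum_comp]
    rfl
  · rw [submatrix_apply, hx.counit_apply]
    simp [Matrix.one_apply]
  · rw [Unitary.mem_iff] at hx' ⊢
    simp only [star_eq_conjTranspose, conjTranspose_submatrix, submatrix_mul_equiv] at hx' ⊢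
    simp [hx'.1, hx'.2]

theorem mul_mem_unitaryCoefficients {a b : H} (ha : a ∈ unitaryCoefficients H)
    (hb : b ∈ unitaryCoefficients H) : a * b ∈ unitaryCoefficients H := by
  obtain ⟨m, x, hx, hx', i, j, rfl⟩ := ha
  obtain ⟨n, y, hy, hy', k, l, rfl⟩ := hb
  obtain ⟨z, hz⟩ : ∃ z : Matrix (Fin m × Fin n) (Fin m × Fin n) H,
      ∀ p q, z p q = x p.1 q.1 * y p.2 q.2 := ⟨fun p q => x p.1 q.1 * y p.2 q.2, fun _ _ => rfl⟩
  rw [← hz (i, k) (j, l)]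
  refine mem_unitaryCoefficients (x := z) ⟨fun p q => ?_, fun p q => ?_⟩ ?_ (i, k) (j, l)
  · simp only [hz, Bialgebra.comul_mul, hx.comul_apply, hy.comul_apply, Finset.sum_mul_sum,
      Algebra.TensorProduct.tmul_mul_tmul, Fintype.sum_prod_type]
  · simp [hz, Bialgebra.counit_mul, hx.counit_apply, hy.counit_apply, Matrix.one_apply, Prod.ext_iff,
      ← ite_and, and_comm]
  · rw [Unitary.mem_iff] at hx' hy' ⊢
    have x1 (i j) := congrFun (congrFun hx'.1 i) j
    have x2 (i j) := congrFun (congrFun hx'.2 i) j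
    have y1 (i j) := congrFun (congrFun hy'.1 i) j
    have y2 (i j) := congrFun (congrFun hy'.2 i) j
    simp only [Matrix.mul_apply, star_apply] at x1 x2 y1 y2
    constructor
    · ext p q
      simp only [Matrix.mul_apply, star_apply, hz, Fintype.sum_prod_type, star_mul]
      rw [Finset.sum_comm]
      have h (b : Fin n) : ∑ a, star (y b p.2) * star (x a p.1) * (x a q.1 * y b q.2) =
          star (y b p.2) * (1 : Matrix (Fin m) (Fin m) H) p.1 q.1 * y b q.2 := by
        rw [← x1, Finset.mul_sum, Finset.sum_mul]
        simp only [mul_assoc]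
      simp only [h]
      by_cases h1 : p.1 = q.1
      · simp [h1, y1, Matrix.one_apply, Prod.ext_iff]
      · simp [h1, Prod.ext_iff]
    · ext p q
      simp only [Matrix.mul_apply, star_apply, hz, Fintype.sum_prod_type, star_mul]
      have h (a : Fin m) : ∑ b, x p.1 a * y p.2 b * (star (y q.2 b) * star (x q.1 a)) =
          x p.1 a * (1 : Matrix (Fin n) (Fin n) H) p.2 q.2 * star (x q.1 a) := by
        rw [← y2, Finset.mul_sum, Finset.sum_mul]
        simp only [mul_assoc]
      simp only [h]
      by_cases h1 : p.2 = q.2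
      · simp [h1, x2, Matrix.one_apply, Prod.ext_iff]
      · simp [h1, Prod.ext_iff]

theorem one_mem_unitaryCoefficients : (1 : H) ∈ unitaryCoefficients H := by
  refine mem_unitaryCoefficients (x := (1 : Matrix (Fin 1) (Fin 1) H)) ⟨fun i j => ?_, fun i j => ?_⟩
    (one_mem _) 0 0
  · obtain rfl := Subsingleton.elim i j
    simp [Matrix.one_apply, Subsingleton.elim i 0, Algebra.TensorProduct.one_def]
  · simp [Matrix.one_apply, Subsingleton.elim i j]

end coefficients

/-- A scalar conjugate of a coefficient matrix is a coefficient matrix. -/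
theorem IsCoefficientMatrix.conj {H : Type*} [Ring H] [HopfAlgebra ℂ H] {n : ℕ} {x : Matrix (Fin n) (Fin n) H}
    (hx : IsCoefficientMatrix x) {M N : Matrix (Fin n) (Fin n) ℂ} (h : M * N = 1) :
    IsCoefficientMatrix (scalarMat H M * x * scalarMat H N) := by
  have h' : N * M = 1 := mul_eq_one_comm.1 h
  have h1 : x.map (Bialgebra.comulAlgHom ℂ H) = x.map (Algebra.TensorProduct.includeLeft (S := ℂ)) *
      x.map (Algebra.TensorProduct.includeRight (R := ℂ)) := by
    ext i j
    simp [hx.comul_apply, Matrix.mul_apply]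
  have h2 : x.map (Bialgebra.counitAlgHom ℂ H) = 1 := by
    ext i j
    simp [hx.counit_apply]
  obtain ⟨y, hy⟩ : ∃ y, y = scalarMat H M * x * scalarMat H N := ⟨_, rfl⟩
  rw [← hy]
  refine ⟨fun i j => ?_, fun i j => ?_⟩
  · have e : y.map (Bialgebra.comulAlgHom ℂ H) = y.map (Algebra.TensorProduct.includeLeft (S := ℂ)) *
        y.map (Algebra.TensorProduct.includeRight (R := ℂ)) := by
      simp only [hy, Matrix.map_mul, scalarMat_map, h1]
      rw [mul_assoc (scalarMat _ M * _), ← mul_assoc (scalarMat _ N), ← mul_assoc (scalarMat _ N),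
        ← scalarMat_mul, h', scalarMat_one, one_mul]
      simp only [mul_assoc]
    have := congrFun (congrFun e i) j
    simpa [Matrix.mul_apply] using this
  · have e : y.map (Bialgebra.counitAlgHom ℂ H) = 1 := by
      simp only [hy, Matrix.map_mul, scalarMat_map, h2, mul_one]
      rw [← scalarMat_mul, h, scalarMat_one]
    exact congrFun (congrFun e i) j

namespace AuAlgebra

variable {n : ℕ} (Q : PosMatrix n)

theorem std_isCoefficientMatrix : IsCoefficientMatrix (std.{u} Q) :=
  ⟨comul_std Q, counit_std Q⟩

theorem stdStar_isCoefficientMatrix : IsCoefficientMatrix (stdStar.{u} Q) :=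
  ⟨comul_stdStar Q, counit_stdStar Q⟩

theorem star_std_matrix : star (std.{u} Q) = (stdStar Q)ᵀ := by
  ext i j; simp

theorem star_twist : star (twist Q (stdStar.{u} Q)) = twistAdj Q (std Q) := by
  have hs (M : Matrix (Fin n) (Fin n) ℂ) :
      star (scalarMat (AuAlgebra.{u} Q) M) = scalarMat _ Mᴴ := by
    ext i j; simp [star_algebraMap']
  have hu : star (stdStar.{u} Q) = (std Q)ᵀ := by
    ext i j; simp
  simp only [twist, twistAdj, star_mul, hs, hu, Q.root_conjTranspose, Q.inv_conjTranspose, mul_assoc]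

/-- The standard matrix `u` is unitary. -/
theorem std_mem_unitary : std.{u} Q ∈ unitary (Matrix (Fin n) (Fin n) (AuAlgebra.{u} Q)) := by
  rw [Unitary.mem_iff, star_std_matrix]
  exact ⟨(std_relations Q).adjoint_mul, (std_relations Q).mul_adjoint⟩

/-- The matrix `Q^{1/2} ū Q^{-1/2}` is unitary. -/
theorem twist_mem_unitary :
    twist Q (stdStar.{u} Q) ∈ unitary (Matrix (Fin n) (Fin n) (AuAlgebra.{u} Q)) := by
  rw [Unitary.mem_iff, star_twist]
  exact ⟨(std_relations Q).adjoint_mul_twist, (std_relations Q).twist_mul_adjoint⟩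

theorem span_unitaryCoefficients :
    Submodule.span ℂ (unitaryCoefficients (AuAlgebra.{u} Q)) = ⊤ := by
  rw [eq_top_iff]
  rintro a -
  induction a using AuAlgebra.induction with
  | std i j =>
    exact Submodule.subset_span
      (mem_unitaryCoefficients (std_isCoefficientMatrix Q) (std_mem_unitary Q) i j)
  | stdStar i j =>
    have h : stdStar.{u} Q = scalarMat _ Q.root⁻¹ * twist Q (stdStar Q) * scalarMat _ Q.root := by
      simp only [twist]
      rw [mul_assoc, mul_assoc, scalar_inv_root, mul_one, ← mul_assoc, scalar_inv_root, one_mul]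
    rw [h]
    simp only [Matrix.mul_apply (M := _ * _), Matrix.mul_apply (M := scalarMat _ Q.root⁻¹),
      scalarMat_apply, ← Algebra.commutes, ← Algebra.smul_def]
    refine Submodule.sum_mem _ fun p _ => Submodule.smul_mem _ _ (Submodule.sum_mem _ fun q _ =>
      Submodule.smul_mem _ _ (Submodule.subset_span ?_))
    exact mem_unitaryCoefficients ((stdStar_isCoefficientMatrix Q).conj Q.root_mul_inv)
      (twist_mem_unitary Q) q p
  | alg c =>
    rw [Algebra.algebraMap_eq_smul_one]
    exact Submodule.smul_mem _ _ (Submodule.subset_span one_mem_unitaryCoefficients)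
  | add a b ha hb => exact Submodule.add_mem _ ha hb
  | mul a b ha hb =>
    have h := Submodule.mul_mem_mul ha hb
    rw [Submodule.span_mul_span] at h
    refine Submodule.span_mono ?_ h
    rintro _ ⟨x, hx, y, hy, rfl⟩
    exact mul_mem_unitaryCoefficients hx hy

end AuAlgebra

/-- The universal CQG algebra `A_u(Q)`. -/
noncomputable def Au {n : ℕ} (Q : PosMatrix n) : CQG.{u} where
  carrier := AuAlgebra.{u} Q
  span_unitaryCoefficients := AuAlgebra.span_unitaryCoefficients Q

end QuantumGroup

/-! ### Regular generators -/

/-- A class `P` of objects of a category is a generator if any two distinct parallel arrows stay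
distinct upon composition with some arrow from an object in `P`.  It is a regular generator if
moreover every object is the coequalizer of two parallel arrows `f, g : Y ⟶ Z` such that `Y` and `Z`
are (small) coproducts of objects in `P`. -/
def IsRegularGenerator {C : Type (u + 1)} [Category.{u} C] (P : ObjectProperty C) : Prop :=
  P.IsSeparating ∧
    ∀ X : C, ∃ (I J : Type u) (s : I → C) (t : J → C) (Y : Cofan s) (Z : Cofan t) (f g : Y.pt ⟶ Z.pt)
      (π : Z.pt ⟶ X) (w : f ≫ π = g ≫ π), (∀ i, P (s i)) ∧ (∀ j, P (t j)) ∧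
        Nonempty (IsColimit Y) ∧ Nonempty (IsColimit Z) ∧ Nonempty (IsColimit (Cofork.ofπ π w))

/-! The structure maps of a colimit of underlying algebras are given by its universal property, so
colimits of CQG algebras are colimits of algebras; in particular filtered colimits are computed on
underlying sets. A morphism out of `A_u(Q)` is an `n × n` matrix satisfying finitely many algebraic
relations and the identities for the comultiplication, all of which lift from a filtered colimit to
a finite stage.

For the generator, conjugates of unitary comodules are unitarizable: if `φ ↦ φ(w)` is a
`*`-representation of the convolution algebra of functionals and `σ` is a representation that
factors through it, then `R = ∑ σ(d) σ(d)ᴴ`, over `d` that map to an orthonormal basis, is a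
positive intertwiner between `σ` and its adjoint. Hence every unitary coefficient matrix comes from
some `A_u(Q)`.

Let `π : Y ⟶ X` be a morphism from a coproduct of `A_u(Q)`s that is surjective, and let `s`
identify any two morphisms from an `A_u(Q)` that `π` identifies. Let `x` be a comodule of `Y`,
coming from `A_u(Rᵀ)`. Every unitary endomorphism `U` over `X` commuting with `R` gives two lifts
`x` and `U x Uᴴ`, so that `U` is an endomorphism over `S` as well. Unitaries span the endomorphisms
that commute with `R`, and a general endomorphism is a sum of eigenvectors of conjugation by `R`,
which reduce to the commuting case on `x ⊕ x`. So endomorphisms over `X` are endomorphisms over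
`S`, and by the double commutant theorem the linear relations between the coefficients over `X`
also hold over `S`. Thus `ker π ⊆ ker s` and `s` factors through `π`. -/

namespace QuantumGroup

open scoped TensorProduct
open Matrix

namespace IsCoefficientMatrix

variable {H : Type*} [Ring H] [HopfAlgebra ℂ H] {ι : Type*} [Fintype ι] [DecidableEq ι]
  {x : Matrix ι ι H}

theorem antipode_mul (hx : IsCoefficientMatrix x) :
    x.map (HopfAlgebraStruct.antipode ℂ) * x = 1 := by
  ext i j
  have h := HopfAlgebra.mul_antipode_rTensor_comul_apply (R := ℂ) (x i j)
  rw [hx.comul_apply, hx.counit_apply] at h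
  simpa [Matrix.mul_apply, Matrix.one_apply, apply_ite (algebraMap ℂ H)] using h

theorem mul_antipode (hx : IsCoefficientMatrix x) :
    x * x.map (HopfAlgebraStruct.antipode ℂ) = 1 := by
  ext i j
  have h := HopfAlgebra.mul_antipode_lTensor_comul_apply (R := ℂ) (x i j)
  rw [hx.comul_apply, hx.counit_apply] at h
  simpa [Matrix.mul_apply, Matrix.one_apply, apply_ite (algebraMap ℂ H)] using h

theorem mul_eq_one_comm (hx : IsCoefficientMatrix x) {y : Matrix ι ι H} :
    x * y = 1 ↔ y * x = 1 := by
  constructor <;> intro h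
  · rw [← left_inv_eq_right_inv hx.antipode_mul h, hx.antipode_mul]
  · rw [left_inv_eq_right_inv h hx.mul_antipode, hx.mul_antipode]

theorem antipode_apply [StarRing H] (hx : IsCoefficientMatrix x)
    (hx' : x ∈ unitary (Matrix ι ι H)) (i j : ι) :
    HopfAlgebraStruct.antipode ℂ (x i j) = star (x j i) := by
  have h : x.map (HopfAlgebraStruct.antipode ℂ) = star x :=
    left_inv_eq_right_inv hx.antipode_mul (Unitary.mem_iff.1 hx').2
  exact congrFun (congrFun h i) j

end IsCoefficientMatrix

section HopfStarHom

variable {H K L : Type*} [Ring H] [HopfAlgebra ℂ H] [StarRing H] [Ring K] [HopfAlgebra ℂ K]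
  [StarRing K] [Ring L] [HopfAlgebra ℂ L] [StarRing L]

/-- The algebra homomorphism `f` is a morphism of Hopf `*`-algebras.  This is the unbundled form of
`CQG.Hom`, for algebras that are not yet known to be CQG algebras. -/
structure IsHopfStarHom (f : H →ₐ[ℂ] K) : Prop where
  map_star (a : H) : f (star a) = star (f a)
  comul_map (a : H) : Coalgebra.comul (R := ℂ) (f a) =
    Algebra.TensorProduct.map f f (Coalgebra.comul (R := ℂ) a)
  counit_map (a : H) : Coalgebra.counit (R := ℂ) (f a) = Coalgebra.counit (R := ℂ) a

variable {f : H →ₐ[ℂ] K} {ι : Type*} {x : Matrix ι ι H}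

theorem IsHopfStarHom.star_map (hf : IsHopfStarHom f) (x : Matrix ι ι H) :
    star (x.map f) = (star x).map f := by
  ext i j
  exact (hf.map_star _).symm

theorem IsHopfStarHom.map_star_map (hf : IsHopfStarHom f) (x : Matrix ι ι H) :
    (x.map f).map star = (x.map star).map f := by
  ext i j
  exact (hf.map_star _).symm

variable [Fintype ι] [DecidableEq ι]

theorem IsCoefficientMatrix.map (hx : IsCoefficientMatrix x) (hf : IsHopfStarHom f) :
    IsCoefficientMatrix (x.map f) where
  comul_apply i j := by simp [hf.comul_map, hx.comul_apply]
  counit_apply i j := by simp [hf.counit_map, hx.counit_apply]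

theorem IsHopfStarHom.map_mem_unitary (hf : IsHopfStarHom f)
    (hx : x ∈ unitary (Matrix ι ι H)) : x.map f ∈ unitary (Matrix ι ι K) := by
  rw [Unitary.mem_iff] at hx ⊢
  rw [hf.star_map, ← Matrix.map_mul, ← Matrix.map_mul, hx.1, hx.2]
  simp

theorem IsHopfStarHom.map_span_unitaryCoefficients_le (hf : IsHopfStarHom f) :
    (Submodule.span ℂ (unitaryCoefficients H)).map f.toLinearMap ≤
      Submodule.span ℂ (unitaryCoefficients K) := by
  rw [Submodule.map_span]
  refine Submodule.span_mono ?_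
  rintro _ ⟨_, ⟨n, x, hx, hx', i, j, rfl⟩, rfl⟩
  exact ⟨n, x.map f, hx.map hf, hf.map_mem_unitary hx', i, j, rfl⟩

theorem IsHopfStarHom.map_antipode (hf : IsHopfStarHom f)
    (hH : Submodule.span ℂ (unitaryCoefficients H) = ⊤) (a : H) :
    f (HopfAlgebraStruct.antipode ℂ a) = HopfAlgebraStruct.antipode ℂ (f a) := by
  suffices f.toLinearMap ∘ₗ HopfAlgebraStruct.antipode ℂ =
      HopfAlgebraStruct.antipode ℂ ∘ₗ f.toLinearMap from LinearMap.congr_fun this a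
  refine LinearMap.ext_on hH ?_
  rintro _ ⟨n, x, hx, hx', i, j, rfl⟩
  have h := (hx.map hf).antipode_apply (hf.map_mem_unitary hx') i j
  simp only [Matrix.map_apply] at h
  simp [h, hx.antipode_apply hx', hf.map_star]

theorem IsHopfStarHom.of_comp_surjective (hf : IsHopfStarHom f) (hf' : Function.Surjective f)
    {g : K →ₐ[ℂ] L} (hgf : IsHopfStarHom (g.comp f)) : IsHopfStarHom g where
  map_star := hf'.forall.2 fun a => by
    rw [← hf.map_star]
    exact hgf.map_star a
  comul_map := hf'.forall.2 fun a => by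
    rw [hf.comul_map]
    refine (hgf.comul_map a).trans ?_
    rw [Algebra.TensorProduct.map_comp]
    rfl
  counit_map := hf'.forall.2 fun a => by
    rw [hf.counit_map]
    exact hgf.counit_map a

end HopfStarHom

end QuantumGroup

open QuantumGroup

namespace CQG

open scoped TensorProduct

variable {A B C : CQG.{u}}

/-- The underlying algebra homomorphism of a morphism of CQG algebras. -/
def alg (f : A ⟶ B) : A →ₐ[ℂ] B := AlgHomClass.toAlgHom (Hom.toBialgHom f)

theorem isHopfStarHom_alg (f : A ⟶ B) : IsHopfStarHom (alg f) where
  map_star := Hom.map_star f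
  comul_map a := (CoalgHomClass.map_comp_comul_apply (Hom.toBialgHom f) a).symm
  counit_map := CoalgHomClass.counit_comp_apply (Hom.toBialgHom f)

/-- The morphism of CQG algebras with a given underlying algebra homomorphism. -/
def homMk (f : A →ₐ[ℂ] B) (hf : IsHopfStarHom f) : A ⟶ B :=
  Hom.mk (BialgHom.ofAlgHom f (AlgHom.ext hf.counit_map)
    (AlgHom.ext fun a => (hf.comul_map a).symm)) hf.map_star

theorem hom_ext {f g : A ⟶ B} (h : ∀ a, alg f a = alg g a) : f = g := Hom.ext (BialgHom.ext h)

@[simp] theorem alg_comp (f : A ⟶ B) (g : B ⟶ C) : alg (f ≫ g) = (alg g).comp (alg f) := rfl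

end CQG

/-! ### Colimits of CQG algebras -/

section AlgColimit

variable {R : Type*} [CommRing R] {J : Type*} [Quiver J] {A : J → Type*} [∀ j, Ring (A j)]
  [∀ j, Algebra R (A j)] (f : ∀ ⦃i j⦄, (i ⟶ j) → A i →ₐ[R] A j)

/-- The relations that turn the maps from the algebras of a diagram to the free algebra on all their
elements into a compatible family of algebra homomorphisms. -/
inductive AlgColimitRel : FreeAlgebra R (Σ j, A j) → FreeAlgebra R (Σ j, A j) → Prop
  | algebraMap (j : J) (c : R) :
      AlgColimitRel (FreeAlgebra.ι R ⟨j, algebraMap R (A j) c⟩) (algebraMap R _ c)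
  | add (j : J) (a b : A j) : AlgColimitRel (FreeAlgebra.ι R ⟨j, a + b⟩)
      (FreeAlgebra.ι R ⟨j, a⟩ + FreeAlgebra.ι R ⟨j, b⟩)
  | mul (j : J) (a b : A j) : AlgColimitRel (FreeAlgebra.ι R ⟨j, a * b⟩)
      (FreeAlgebra.ι R ⟨j, a⟩ * FreeAlgebra.ι R ⟨j, b⟩)
  | map {i j : J} (h : i ⟶ j) (a : A i) :
      AlgColimitRel (FreeAlgebra.ι R ⟨j, f h a⟩) (FreeAlgebra.ι R ⟨i, a⟩)

/-- The colimit of a diagram of noncommutative algebras. -/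
def AlgColimit : Type _ := RingQuot (AlgColimitRel f)

namespace AlgColimit

noncomputable instance : Ring (AlgColimit f) := inferInstanceAs (Ring (RingQuot (AlgColimitRel f)))

noncomputable instance : Algebra R (AlgColimit f) :=
  inferInstanceAs (Algebra R (RingQuot (AlgColimitRel f)))

/-- The quotient map from the free algebra to the colimit. -/
noncomputable def mk : FreeAlgebra R (Σ j, A j) →ₐ[R] AlgColimit f :=
  RingQuot.mkAlgHom R (AlgColimitRel f)

variable {f} in
theorem mk_eq_mk {x y : FreeAlgebra R (Σ j, A j)} (h : AlgColimitRel f x y) : mk f x = mk f y :=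
  RingQuot.mkAlgHom_rel R h

/-- The maps of the colimit cocone. -/
noncomputable def incl (j : J) : A j →ₐ[R] AlgColimit f where
  toFun a := mk f (FreeAlgebra.ι R ⟨j, a⟩)
  map_one' := by simpa using mk_eq_mk (.algebraMap (f := f) j 1)
  map_mul' a b := by rw [mk_eq_mk (.mul j a b), map_mul]
  map_zero' := by simpa using mk_eq_mk (.algebraMap (f := f) j 0)
  map_add' a b := by rw [mk_eq_mk (.add j a b), map_add]
  commutes' c := by rw [mk_eq_mk (.algebraMap j c), AlgHom.commutes]

theorem incl_map {i j : J} (h : i ⟶ j) (a : A i) : incl f j (f h a) = incl f i a :=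
  mk_eq_mk (.map h a)

theorem incl_comp {i j : J} (h : i ⟶ j) : (incl f j).comp (f h) = incl f i :=
  AlgHom.ext (incl_map f h)

variable {f} {B : Type*}

/-- The universal property of the colimit. -/
noncomputable def lift [Semiring B] [Algebra R B] (g : ∀ j, A j →ₐ[R] B)
    (hg : ∀ ⦃i j⦄ (h : i ⟶ j), (g j).comp (f h) = g i) : AlgColimit f →ₐ[R] B :=
  RingQuot.liftAlgHom R ⟨FreeAlgebra.lift R fun x => g x.1 x.2, fun _ _ h => by
    cases h with
    | map h a => simpa using AlgHom.congr_fun (hg h) a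
    | _ => simp⟩

@[simp] theorem lift_incl [Semiring B] [Algebra R B] (g : ∀ j, A j →ₐ[R] B)
    (hg : ∀ ⦃i j⦄ (h : i ⟶ j), (g j).comp (f h) = g i) (j : J) (a : A j) :
    lift g hg (incl f j a) = g j a :=
  (RingQuot.liftAlgHom_mkAlgHom_apply R _ _ _).trans (FreeAlgebra.lift_ι_apply _ _)

@[elab_as_elim]
theorem induction {p : AlgColimit f → Prop} (incl : ∀ j a, p (incl f j a))
    (algebraMap : ∀ c, p (algebraMap R _ c)) (add : ∀ a b, p a → p b → p (a + b))
    (mul : ∀ a b, p a → p b → p (a * b)) (a) : p a := by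
  obtain ⟨x, rfl⟩ := RingQuot.mkAlgHom_surjective R (AlgColimitRel f) a
  change p (mk f x)
  induction x using FreeAlgebra.induction with
  | grade0 c => simpa using algebraMap c
  | grade1 x => exact incl x.1 x.2
  | mul a b ha hb => simpa using mul _ _ ha hb
  | add a b ha hb => simpa using add _ _ ha hb

theorem algHom_ext [Semiring B] [Algebra R B] {g g' : AlgColimit f →ₐ[R] B}
    (h : ∀ j, g.comp (incl f j) = g'.comp (incl f j)) : g = g' := by
  ext a
  induction a using AlgColimit.induction with
  | incl j a => exact AlgHom.congr_fun (h j) a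
  | algebraMap c => simp
  | add a b ha hb => simp [ha, hb]
  | mul a b ha hb => simp [ha, hb]

end AlgColimit

end AlgColimit

namespace QuantumGroup

open scoped TensorProduct
open MulOpposite
open QuantumGroup.AuAlgebra (ConjOp toConj ofConj)

section

variable {A B : Type*} [Ring A] [Algebra ℂ A] [Ring B] [Algebra ℂ B]

/-- An algebra homomorphism composed with the involution of its source, as an algebra homomorphism
to the conjugate opposite algebra of its target. -/
noncomputable def mapStar [StarRing A] [StarModule ℂ A] (f : A →ₐ[ℂ] B) : A →ₐ[ℂ] ConjOp B where
  toFun a := toConj (f (star a))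
  map_one' := congrArg op (by simp)
  map_mul' a b := congrArg op (show f (star (a * b)) = f (star b) * f (star a) by simp)
  map_zero' := congrArg op (by simp)
  map_add' a b := congrArg op (show f (star (a + b)) = f (star a) + f (star b) by simp)
  commutes' c := congrArg op (by rw [← algebraMap_star_comm, AlgHom.commutes]; rfl)

theorem star_tensorMap [StarRing A] [StarModule ℂ A] [StarRing B] [StarModule ℂ B]
    {f : A →ₐ[ℂ] B} (hf : ∀ a, f (star a) = star (f a)) (t : A ⊗[ℂ] A) :
    star (Algebra.TensorProduct.map f f t) = Algebra.TensorProduct.map f f (star t) := by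
  induction t with
  | zero => simp
  | add x y hx hy => simp only [map_add, star_add, hx, hy]
  | tmul p q => simp [hf]

theorem mul'_rTensor_tensorMap (f : A →ₐ[ℂ] B) {S : A →ₗ[ℂ] A} {T : B →ₗ[ℂ] B}
    (h : ∀ a, T (f a) = f (S a)) (t : A ⊗[ℂ] A) :
    LinearMap.mul' ℂ B (T.rTensor B (Algebra.TensorProduct.map f f t)) =
      f (LinearMap.mul' ℂ A (S.rTensor A t)) := by
  induction t with
  | zero => simp
  | add x y hx hy => simp only [map_add, hx, hy]
  | tmul p q => simp [h]

theorem mul'_lTensor_tensorMap (f : A →ₐ[ℂ] B) {S : A →ₗ[ℂ] A} {T : B →ₗ[ℂ] B}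
    (h : ∀ a, T (f a) = f (S a)) (t : A ⊗[ℂ] A) :
    LinearMap.mul' ℂ B (T.lTensor B (Algebra.TensorProduct.map f f t)) =
      f (LinearMap.mul' ℂ A (S.lTensor A t)) := by
  induction t with
  | zero => simp
  | add x y hx hy => simp only [map_add, hx, hy]
  | tmul p q => simp [h]

end

variable {H : Type*} [Ring H] [HopfAlgebra ℂ H] [StarRing H]

theorem mul_mem_span_unitaryCoefficients {a b : H}
    (ha : a ∈ Submodule.span ℂ (unitaryCoefficients H))
    (hb : b ∈ Submodule.span ℂ (unitaryCoefficients H)) :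
    a * b ∈ Submodule.span ℂ (unitaryCoefficients H) := by
  have h := Submodule.mul_mem_mul ha hb
  rw [Submodule.span_mul_span] at h
  exact Submodule.span_mono (Set.mul_subset_iff.2 fun _ hx _ hy =>
    mul_mem_unitaryCoefficients hx hy) h

end QuantumGroup

namespace CQG

open scoped TensorProduct
open AlgColimit MulOpposite
open QuantumGroup.AuAlgebra (ConjOp toConj ofConj)

variable {J : Type u} [SmallCategory J] (F : J ⥤ CQG.{u})

/-- The diagram of algebras underlying a diagram of CQG algebras, in the form expected by
`AlgColimit`. -/
def algMap ⦃i j : J⦄ (h : i ⟶ j) : F.obj i →ₐ[ℂ] F.obj j := alg (F.map h)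

theorem isHopfStarHom_algMap {i j : J} (h : i ⟶ j) : IsHopfStarHom (algMap F h) :=
  isHopfStarHom_alg (F.map h)

/-- The colimit of the underlying algebras of a diagram of CQG algebras. -/
abbrev Colim : Type u := AlgColimit (algMap F)

namespace Colim

/-- The involution, as an algebra homomorphism to the conjugate opposite algebra. -/
noncomputable def starHom : Colim F →ₐ[ℂ] ConjOp (Colim F) :=
  lift (fun j => mapStar (incl (algMap F) j)) fun i j h => AlgHom.ext fun a =>
    congrArg op (by
      rw [AlgHom.coe_toRingHom, ← (isHopfStarHom_algMap F h).map_star]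
      exact incl_map (algMap F) h (star a))

noncomputable instance : Star (Colim F) := ⟨fun a => ofConj (starHom F a)⟩

theorem star_incl (j : J) (a : F.obj j) : star (incl (algMap F) j a) = incl (algMap F) j (star a) :=
  congrArg ofConj (lift_incl (f := algMap F) _ _ j a)

theorem star_algebraMap (c : ℂ) : star (algebraMap ℂ (Colim F) c) = algebraMap ℂ _ (star c) :=
  congrArg ofConj ((starHom F).commutes c)

protected theorem star_add (a b : Colim F) : star (a + b) = star a + star b :=
  congrArg ofConj (map_add (starHom F) a b)

protected theorem star_mul (a b : Colim F) : star (a * b) = star b * star a :=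
  congrArg ofConj (map_mul (starHom F) a b)

noncomputable instance : StarRing (Colim F) where
  star_involutive a := by
    induction a using induction with
    | incl j a => rw [star_incl, star_incl, star_star]
    | algebraMap c => rw [star_algebraMap, star_algebraMap, star_star]
    | add a b ha hb => rw [Colim.star_add, Colim.star_add, ha, hb]
    | mul a b ha hb => rw [Colim.star_mul, Colim.star_mul, ha, hb]
  star_mul := Colim.star_mul F
  star_add := Colim.star_add F

instance : StarModule ℂ (Colim F) where
  star_smul c a := by
    rw [Algebra.smul_def, Colim.star_mul, star_algebraMap, Algebra.smul_def, Algebra.commutes]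

/-- The comultiplication of the colimit. -/
noncomputable def comulHom : Colim F →ₐ[ℂ] Colim F ⊗[ℂ] Colim F :=
  lift (fun j => (Algebra.TensorProduct.map (incl (algMap F) j) (incl (algMap F) j)).comp
    (Bialgebra.comulAlgHom ℂ (F.obj j))) fun i j h => by
      have hcomul : (Bialgebra.comulAlgHom ℂ (F.obj j)).comp (algMap F h) =
          (Algebra.TensorProduct.map (algMap F h) (algMap F h)).comp
            (Bialgebra.comulAlgHom ℂ (F.obj i)) :=
        AlgHom.ext (isHopfStarHom_algMap F h).comul_map
      rw [AlgHom.comp_assoc, hcomul, ← AlgHom.comp_assoc, ← Algebra.TensorProduct.map_comp,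
        incl_comp]

/-- The counit of the colimit. -/
noncomputable def counitHom : Colim F →ₐ[ℂ] ℂ :=
  lift (fun j => Bialgebra.counitAlgHom ℂ (F.obj j)) fun _ _ h =>
    AlgHom.ext (isHopfStarHom_algMap F h).counit_map

theorem comulHom_comp_incl (j : J) :
    (comulHom F).toLinearMap ∘ₗ (incl (algMap F) j).toLinearMap =
      TensorProduct.map (incl (algMap F) j).toLinearMap (incl (algMap F) j).toLinearMap ∘ₗ
        Coalgebra.comul :=
  LinearMap.ext (lift_incl (f := algMap F) _ _ j)

theorem counitHom_comp_incl (j : J) :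
    (counitHom F).toLinearMap ∘ₗ (incl (algMap F) j).toLinearMap = Coalgebra.counit :=
  LinearMap.ext (lift_incl (f := algMap F) _ _ j)

noncomputable instance : Bialgebra ℂ (Colim F) := by
  refine .ofAlgHom (comulHom F) (counitHom F) ?_ ?_ ?_ <;>
    refine algHom_ext fun j => AlgHom.toLinearMap_injective ?_ <;>
    simp only [coassoc_simps, AlgHom.comp_toLinearMap, Algebra.TensorProduct.toLinearMap_map,
      comulHom_comp_incl, counitHom_comp_incl]
  · simp [coassoc_simps]
  · rw [CoassocSimps.map_counit_comp_comul_left]; rfl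
  · rw [CoassocSimps.map_counit_comp_comul_right]; rfl

theorem comul_incl (j : J) (a : F.obj j) :
    Coalgebra.comul (R := ℂ) (incl (algMap F) j a) =
      Algebra.TensorProduct.map (incl (algMap F) j) (incl (algMap F) j)
        (Coalgebra.comul (R := ℂ) a) :=
  lift_incl (f := algMap F) _ _ j a

theorem counit_incl (j : J) (a : F.obj j) :
    Coalgebra.counit (R := ℂ) (incl (algMap F) j a) = Coalgebra.counit (R := ℂ) a :=
  lift_incl (f := algMap F) _ _ j a

/-- The antipode, as an algebra homomorphism to the opposite algebra. -/
noncomputable def antipodeHom : Colim F →ₐ[ℂ] (Colim F)ᵐᵒᵖ :=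
  lift (fun j => (AlgHom.op (incl (algMap F) j)).comp (HopfAlgebra.antipodeAlgHomOp ℂ (F.obj j)))
    fun i j h => AlgHom.ext fun a => unop_injective <| by
      have hS := (isHopfStarHom_algMap F h).map_antipode (F.obj i).span_unitaryCoefficients a
      simpa [← hS] using incl_map (algMap F) h _

/-- The antipode of the colimit. -/
noncomputable def antipodeLin : Colim F →ₗ[ℂ] Colim F :=
  (opLinearEquiv ℂ).symm.toLinearMap ∘ₗ (antipodeHom F).toLinearMap

theorem antipodeLin_incl (j : J) (a : F.obj j) :
    antipodeLin F (incl (algMap F) j a) = incl (algMap F) j (HopfAlgebraStruct.antipode ℂ a) := by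
  simp [antipodeLin, antipodeHom]

theorem antipodeLin_mul (a b : Colim F) :
    antipodeLin F (a * b) = antipodeLin F b * antipodeLin F a := by
  simp [antipodeLin]

theorem antipodeLin_algebraMap (c : ℂ) :
    antipodeLin F (algebraMap ℂ (Colim F) c) = algebraMap ℂ _ c := by
  simp [antipodeLin, MulOpposite.algebraMap_apply]

theorem antipodeLin_one : antipodeLin F (1 : Colim F) = 1 := by
  simpa using antipodeLin_algebraMap F 1

noncomputable instance : HopfAlgebra ℂ (Colim F) where
  antipode := antipodeLin F
  mul_antipode_rTensor_comul := LinearMap.ext fun a => by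
    change LinearMap.mul' ℂ _ ((antipodeLin F).rTensor _ (Coalgebra.comul a)) =
      algebraMap ℂ _ (Coalgebra.counit a)
    induction a using induction with
    | incl j a =>
      rw [comul_incl, counit_incl, mul'_rTensor_tensorMap _ (antipodeLin_incl F j),
        HopfAlgebra.mul_antipode_rTensor_comul_apply, AlgHom.commutes]
    | algebraMap c => simp [antipodeLin_algebraMap, Algebra.TensorProduct.algebraMap_apply]
    | add a b ha hb => simp only [map_add, ha, hb]
    | mul a b ha hb => exact AuAlgebra.antipode_left_mul _ (antipodeLin_mul F) ha hb
  mul_antipode_lTensor_comul := LinearMap.ext fun a => by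
    change LinearMap.mul' ℂ _ ((antipodeLin F).lTensor _ (Coalgebra.comul a)) =
      algebraMap ℂ _ (Coalgebra.counit a)
    induction a using induction with
    | incl j a =>
      rw [comul_incl, counit_incl, mul'_lTensor_tensorMap _ (antipodeLin_incl F j),
        HopfAlgebra.mul_antipode_lTensor_comul_apply, AlgHom.commutes]
    | algebraMap c => simp [antipodeLin_one, Algebra.TensorProduct.algebraMap_apply]
    | add a b ha hb => simp only [map_add, ha, hb]
    | mul a b ha hb => exact AuAlgebra.antipode_right_mul _ (antipodeLin_mul F) ha hb

theorem isHopfStarHom_incl (j : J) : IsHopfStarHom (incl (algMap F) j) where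
  map_star a := (star_incl F j a).symm
  comul_map := comul_incl F j
  counit_map := counit_incl F j

instance : IsHopfStarAlgebra (Colim F) where
  comul_star a := by
    induction a using induction with
    | incl j a =>
      rw [star_incl, comul_incl, comul_incl, IsHopfStarAlgebra.comul_star,
        star_tensorMap (isHopfStarHom_incl F j).map_star]
    | algebraMap c => simp [star_algebraMap, Algebra.TensorProduct.algebraMap_apply]
    | add a b ha hb => simp only [map_add, star_add, ha, hb]
    | mul a b ha hb => simp only [star_mul, Bialgebra.comul_mul, ha, hb]
  counit_star a := by
    induction a using induction with
    | incl j a => rw [star_incl, counit_incl, counit_incl, IsHopfStarAlgebra.counit_star]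
    | algebraMap c => simp [star_algebraMap]
    | add a b ha hb => simp only [map_add, star_add, ha, hb]
    | mul a b ha hb => simp only [star_mul, Bialgebra.counit_mul, ha, hb]

theorem span_unitaryCoefficients :
    Submodule.span ℂ (unitaryCoefficients (Colim F)) = ⊤ := by
  refine eq_top_iff.2 fun a _ => ?_
  induction a using induction with
  | incl j a =>
    refine (isHopfStarHom_incl F j).map_span_unitaryCoefficients_le (Submodule.mem_map_of_mem ?_)
    exact (F.obj j).span_unitaryCoefficients ▸ Submodule.mem_top
  | algebraMap c =>
    rw [Algebra.algebraMap_eq_smul_one]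
    exact Submodule.smul_mem _ _ (Submodule.subset_span one_mem_unitaryCoefficients)
  | add a b ha hb => exact Submodule.add_mem _ (ha trivial) (hb trivial)
  | mul a b ha hb => exact mul_mem_span_unitaryCoefficients (ha trivial) (hb trivial)

variable {F} in
theorem isHopfStarHom_of_comp_incl {K : Type*} [Ring K] [HopfAlgebra ℂ K] [StarRing K]
    [StarModule ℂ K] {g : Colim F →ₐ[ℂ] K} (hg : ∀ j, IsHopfStarHom (g.comp (incl (algMap F) j))) :
    IsHopfStarHom g where
  map_star a := by
    induction a using induction with
    | incl j a => rw [star_incl]; exact (hg j).map_star a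
    | algebraMap c => rw [star_algebraMap, AlgHom.commutes, AlgHom.commutes, algebraMap_star_comm]
    | add a b ha hb => simp only [map_add, star_add, ha, hb]
    | mul a b ha hb => simp only [map_mul, star_mul, ha, hb]
  comul_map := AlgHom.congr_fun (φ₁ := (Bialgebra.comulAlgHom ℂ K).comp g)
    (φ₂ := (Algebra.TensorProduct.map g g).comp (Bialgebra.comulAlgHom ℂ (Colim F))) <|
    algHom_ext fun j => AlgHom.ext fun a => by
      refine ((hg j).comul_map a).trans ?_
      rw [Algebra.TensorProduct.map_comp]
      exact congrArg _ (comul_incl F j a).symm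
  counit_map := AlgHom.congr_fun (φ₁ := (Bialgebra.counitAlgHom ℂ K).comp g)
    (φ₂ := Bialgebra.counitAlgHom ℂ (Colim F)) <|
    algHom_ext fun j => AlgHom.ext fun a =>
      ((hg j).counit_map a).trans (counit_incl F j a).symm

end Colim

/-- The colimit cocone of a diagram of CQG algebras. -/
noncomputable def colimCocone : Cocone F where
  pt := { carrier := Colim F, span_unitaryCoefficients := Colim.span_unitaryCoefficients F }
  ι :=
    { app j := homMk _ (Colim.isHopfStarHom_incl F j)
      naturality _ _ h := hom_ext fun a => incl_map (algMap F) h a }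

variable {F} in
/-- The algebra homomorphism underlying the morphism from the colimit to a cocone. -/
noncomputable def colimDescAlg (s : Cocone F) : Colim F →ₐ[ℂ] s.pt :=
  lift (fun j => alg (s.ι.app j)) fun _ _ h => congrArg alg (s.w h)

variable {F} in
theorem colimDescAlg_incl (s : Cocone F) (j : J) (a : F.obj j) :
    colimDescAlg s (incl (algMap F) j a) = alg (s.ι.app j) a :=
  lift_incl (f := algMap F) _ _ j a

variable {F} in
theorem isHopfStarHom_colimDescAlg (s : Cocone F) : IsHopfStarHom (colimDescAlg s) :=
  Colim.isHopfStarHom_of_comp_incl fun j => by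
    have h : (colimDescAlg s).comp (incl (algMap F) j) = alg (s.ι.app j) :=
      AlgHom.ext (colimDescAlg_incl s j)
    exact h ▸ isHopfStarHom_alg (s.ι.app j)

/-- The universal property of the colimit cocone. -/
noncomputable def isColimitColimCocone : IsColimit (colimCocone F) where
  desc s := homMk (A := (colimCocone F).pt) _ (isHopfStarHom_colimDescAlg s)
  fac s j := hom_ext (colimDescAlg_incl s j)
  uniq s _ hm := hom_ext <| AlgHom.congr_fun <| algHom_ext fun j =>
    AlgHom.ext fun a => (AlgHom.congr_fun (congrArg alg (hm j)) a).trans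
      (colimDescAlg_incl s j a).symm

theorem hasColimits : HasColimits CQG.{u} :=
  ⟨fun _ _ => ⟨fun F => ⟨⟨⟨colimCocone F, isColimitColimCocone F⟩⟩⟩⟩⟩

end CQG

/-! ### Filtered colimits of CQG algebras -/

namespace QuantumGroup

theorem ker_tensorMap {K V W : Type*} [Field K] [AddCommGroup V] [Module K V]
    [AddCommGroup W] [Module K W] (p : V →ₗ[K] W) :
    LinearMap.ker (TensorProduct.map p p) =
      LinearMap.range (LinearMap.lTensor V p.ker.subtype) ⊔
        LinearMap.range (LinearMap.rTensor V p.ker.subtype) := by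
  have exact_rangeRestrict : Function.Exact p.ker.subtype p.rangeRestrict := fun x => by
    simp [Subtype.ext_iff]
  have subtype_injective : Function.Injective
      (TensorProduct.map p.range.subtype p.range.subtype) :=
    TensorProduct.map_injective_of_flat_flat _ _ Subtype.val_injective Subtype.val_injective
  rw [← TensorProduct.map_ker exact_rangeRestrict p.surjective_rangeRestrict exact_rangeRestrict
    p.surjective_rangeRestrict, ← LinearMap.ker_comp_of_ker_eq_bot _
    (LinearMap.ker_eq_bot.2 subtype_injective), ← TensorProduct.map_comp]
  rfl

theorem exists_hom_forall_of_finite {J : Type*} [Category* J] [IsFiltered J] {ι : Type*} [Finite ι]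
    {j : J} {P : ι → ∀ k : J, (j ⟶ k) → Prop}
    (hP : ∀ i k l (f : j ⟶ k) (g : k ⟶ l), P i k f → P i l (f ≫ g))
    (h : ∀ i, ∃ k f, P i k f) : ∃ k f, ∀ i, P i k f := by
  classical
  have := Fintype.ofFinite ι
  suffices ∀ s : Finset ι, ∃ k f, ∀ i ∈ s, P i k f by
    obtain ⟨k, f, hf⟩ := this Finset.univ
    exact ⟨k, f, fun i => hf i (Finset.mem_univ i)⟩
  intro s
  induction s using Finset.induction_on with
  | empty => exact ⟨j, 𝟙 j, by simp⟩
  | insert a s _ ih =>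
    obtain ⟨k, f, hf⟩ := ih
    obtain ⟨l, g, hg⟩ := h a
    refine ⟨_, (f ≫ IsFiltered.leftToMax k l) ≫ IsFiltered.coeqHom (f ≫ IsFiltered.leftToMax k l)
      (g ≫ IsFiltered.rightToMax k l), fun i hi => ?_⟩
    rcases Finset.mem_insert.1 hi with rfl | hi
    · rw [IsFiltered.coeq_condition]
      exact hP _ _ _ _ _ (hP _ _ _ _ _ hg)
    · exact hP _ _ _ _ _ (hP _ _ _ _ _ (hf i hi))

end QuantumGroup

namespace CQG

open scoped TensorProduct

/-- The forgetful functor from CQG algebras to algebras.  It is used to transfer the description of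
filtered colimits of algebras to CQG algebras. -/
def toAlgCat : CQG.{u} ⥤ AlgCat.{u} ℂ where
  obj A := AlgCat.of ℂ A
  map f := AlgCat.ofHom (alg f)

section FilteredColimit

variable {J : Type u} [SmallCategory J] {F : J ⥤ CQG.{u}} {c : Cocone F}

/-- The algebra homomorphism from the colimit of a diagram of CQG algebras to a cocone over the
diagram of underlying algebras. -/
noncomputable def toAlgCatDesc (s : Cocone (F ⋙ toAlgCat)) : Colim F →ₐ[ℂ] s.pt :=
  AlgColimit.lift (B := s.pt) (f := algMap F) (fun j => (s.ι.app j).hom)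
    fun _ _ h => congrArg AlgCat.Hom.hom (s.w h)

theorem toAlgCatDesc_incl (s : Cocone (F ⋙ toAlgCat)) (j : J) (a : F.obj j) :
    toAlgCatDesc s (AlgColimit.incl (algMap F) j a) = (s.ι.app j).hom a :=
  AlgColimit.lift_incl (B := s.pt) (f := algMap F) _ _ j a

/-- The algebra underlying the colimit of a diagram of CQG algebras is the colimit of the
underlying algebras. -/
noncomputable def isColimitMapCoconeToAlgCat : IsColimit (toAlgCat.mapCocone (colimCocone F)) where
  desc s := AlgCat.ofHom (toAlgCatDesc s)
  fac s j := AlgCat.hom_ext ℂ <| AlgHom.ext <| toAlgCatDesc_incl s j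
  uniq s _ hm := AlgCat.hom_ext ℂ <| AlgColimit.algHom_ext (f := algMap F) fun j =>
    AlgHom.ext fun a => (AlgHom.congr_fun (congrArg AlgCat.Hom.hom (hm j)) a).trans
      (toAlgCatDesc_incl s j a).symm

instance : PreservesColimit F toAlgCat :=
  preservesColimit_of_preserves_colimit_cocone (isColimitColimCocone F) isColimitMapCoconeToAlgCat

variable [IsFiltered J] (hc : IsColimit c)
include hc

theorem exists_app_eq (a : c.pt) : ∃ j x, alg (c.ι.app j) x = a :=
  Concrete.isColimit_exists_rep (F ⋙ toAlgCat) (isColimitOfPreserves toAlgCat hc)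
    (show toAlgCat.obj c.pt from a)

theorem exists_map_eq {j : J} {x y : F.obj j} (h : alg (c.ι.app j) x = alg (c.ι.app j) y) :
    ∃ (k : J) (f : j ⟶ k), alg (F.map f) x = alg (F.map f) y := by
  obtain ⟨k, f, g, hfg⟩ := Concrete.isColimit_exists_of_rep_eq (F ⋙ toAlgCat)
    (isColimitOfPreserves toAlgCat hc) (i := j) (j := j) x y h
  replace hfg : alg (F.map f) x = alg (F.map g) y := hfg
  refine ⟨_, f ≫ IsFiltered.coeqHom f g, ?_⟩
  conv_rhs => rw [IsFiltered.coeq_condition]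
  simp [hfg]

theorem exists_map_eq_zero {j : J} {x : F.obj j} (h : alg (c.ι.app j) x = 0) :
    ∃ (k : J) (f : j ⟶ k), alg (F.map f) x = 0 := by
  simpa using exists_map_eq hc (x := x) (y := 0) (by rw [h, map_zero])

omit [IsFiltered J] hc in
theorem tensorMap_map_comp {i j k : J} (f : i ⟶ j) (g : j ⟶ k) (t : F.obj i ⊗[ℂ] F.obj i) :
    Algebra.TensorProduct.map (alg (F.map (f ≫ g))) (alg (F.map (f ≫ g))) t =
      Algebra.TensorProduct.map (alg (F.map g)) (alg (F.map g))
        (Algebra.TensorProduct.map (alg (F.map f)) (alg (F.map f)) t) := by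
  rw [F.map_comp, alg_comp, Algebra.TensorProduct.map_comp, AlgHom.comp_apply]

omit hc in
variable (F) in
/-- The tensors over the stage `j` of a filtered diagram that vanish at some later stage. -/
def eventuallyZeroTensors (j : J) : Submodule ℂ (F.obj j ⊗[ℂ] F.obj j) where
  carrier := {t | ∃ (k : J) (f : j ⟶ k),
    Algebra.TensorProduct.map (alg (F.map f)) (alg (F.map f)) t = 0}
  zero_mem' := ⟨j, 𝟙 j, map_zero _⟩
  smul_mem' := by
    rintro r t ⟨k, f, hf⟩
    exact ⟨k, f, by rw [map_smul, hf, smul_zero]⟩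
  add_mem' {s t} hs ht := by
    obtain ⟨k, f, hf⟩ := exists_hom_forall_of_finite (ι := Bool)
      (P := fun i k f => Algebra.TensorProduct.map (alg (F.map f)) (alg (F.map f)) (cond i s t) = 0)
      (fun i k l f g h => by rw [tensorMap_map_comp, h, map_zero])
      (fun i => by cases i; exacts [ht, hs])
    exact ⟨k, f, by rw [map_add]; exact (congrArg₂ _ (hf true) (hf false)).trans (add_zero 0)⟩

theorem ker_tensorMap_app_le (j : J) :
    LinearMap.ker (TensorProduct.map (alg (c.ι.app j)).toLinearMap
      (alg (c.ι.app j)).toLinearMap) ≤ eventuallyZeroTensors F j := by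
  rw [ker_tensorMap]
  refine sup_le ?_ ?_
  · rintro _ ⟨s, rfl⟩
    induction s with
    | zero => rw [map_zero]; exact zero_mem _
    | add x y hx hy => rw [map_add]; exact add_mem hx hy
    | tmul x y =>
      obtain ⟨k, f, hf⟩ := exists_map_eq_zero hc (x := y.1) y.2
      exact ⟨k, f, by simp [hf]⟩
  · rintro _ ⟨s, rfl⟩
    induction s with
    | zero => rw [map_zero]; exact zero_mem _
    | add x y hx hy => rw [map_add]; exact add_mem hx hy
    | tmul x y =>
      obtain ⟨k, f, hf⟩ := exists_map_eq_zero hc (x := x.1) x.2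
      exact ⟨k, f, by simp [hf]⟩

theorem exists_tensorMap_eq {j : J} {s t : F.obj j ⊗[ℂ] F.obj j}
    (h : Algebra.TensorProduct.map (alg (c.ι.app j)) (alg (c.ι.app j)) s =
      Algebra.TensorProduct.map (alg (c.ι.app j)) (alg (c.ι.app j)) t) :
    ∃ (k : J) (f : j ⟶ k), Algebra.TensorProduct.map (alg (F.map f)) (alg (F.map f)) s =
      Algebra.TensorProduct.map (alg (F.map f)) (alg (F.map f)) t := by
  obtain ⟨k, f, hf⟩ := ker_tensorMap_app_le hc j (LinearMap.sub_mem_ker_iff.2 h)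
  exact ⟨k, f, by rwa [map_sub, sub_eq_zero] at hf⟩

variable {ι κ : Type*} [Finite ι] [Finite κ]

theorem exists_matrix_map_app_eq (v : Matrix ι κ c.pt) :
    ∃ (j : J) (x : Matrix ι κ (F.obj j)), x.map (alg (c.ι.app j)) = v := by
  classical
  have := Fintype.ofFinite ι
  have := Fintype.ofFinite κ
  choose j x hx using fun i : ι × κ => exists_app_eq hc (v i.1 i.2)
  obtain ⟨k, hk⟩ := IsFiltered.sup_objs_exists (Finset.univ.image j)
  have f (i) : j i ⟶ k := (hk (Finset.mem_image_of_mem j (Finset.mem_univ i))).some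
  refine ⟨k, Matrix.of fun a b => alg (F.map (f (a, b))) (x (a, b)), ?_⟩
  ext a b
  rw [Matrix.map_apply, Matrix.of_apply, ← hx (a, b), ← c.w (f (a, b))]
  rfl

theorem exists_matrix_map_eq {j : J} {x y : Matrix ι κ (F.obj j)}
    (h : x.map (alg (c.ι.app j)) = y.map (alg (c.ι.app j))) :
    ∃ (k : J) (f : j ⟶ k), x.map (alg (F.map f)) = y.map (alg (F.map f)) := by
  obtain ⟨k, f, hf⟩ := exists_hom_forall_of_finite (ι := ι × κ)
    (P := fun i k f => alg (F.map f) (x i.1 i.2) = alg (F.map f) (y i.1 i.2))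
    (fun i k l f g h => by simp [h])
    (fun i => exists_map_eq hc (congrFun (congrFun h i.1) i.2))
  exact ⟨k, f, Matrix.ext fun a b => hf (a, b)⟩

end FilteredColimit

/-! ### Morphisms out of `A_u(Q)` -/

section Au

open AuAlgebra

variable {n : ℕ} {Q : PosMatrix n} {A B : CQG.{u}}

theorem isHopfStarHom_lift {v : Matrix (Fin n) (Fin n) A} (h : AuRelations Q v (v.map star))
    (hv : IsCoefficientMatrix v) : IsHopfStarHom (lift.{u} h) where
  map_star a := by
    induction a using AuAlgebra.induction with
    | std i j => simp
    | stdStar i j => simp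
    | alg c => rw [star_algebraMap', AlgHom.commutes, AlgHom.commutes, algebraMap_star_comm]
    | add a b ha hb => simp only [map_add, star_add, ha, hb]
    | mul a b ha hb => simp only [map_mul, star_mul, ha, hb]
  comul_map := AlgHom.congr_fun <| AuAlgebra.algHom_ext
    (f := (Bialgebra.comulAlgHom ℂ A).comp (lift h))
    (g := (Algebra.TensorProduct.map (lift h) (lift h)).comp (Bialgebra.comulAlgHom ℂ _))
    (fun i j => by simp [comul_std, hv.comul_apply])
    (fun i j => by simp [comul_stdStar, IsHopfStarAlgebra.comul_star, hv.comul_apply, star_sum])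
  counit_map := AlgHom.congr_fun <| AuAlgebra.algHom_ext
    (f := (Bialgebra.counitAlgHom ℂ A).comp (lift h)) (g := Bialgebra.counitAlgHom ℂ _)
    (fun i j => by simp [counit_std, hv.counit_apply])
    (fun i j => by
      simp [counit_stdStar, IsHopfStarAlgebra.counit_star, hv.counit_apply, Matrix.one_apply])

/-- The morphism out of `A_u(Q)` given by a coefficient matrix satisfying the relations. -/
noncomputable def auDesc (v : Matrix (Fin n) (Fin n) A) (h : AuRelations Q v (v.map star))
    (hv : IsCoefficientMatrix v) : Au.{u} Q ⟶ A :=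
  homMk (A := Au Q) (lift h) (isHopfStarHom_lift h hv)

/-- The image of the standard matrix of `A_u(Q)` under a morphism, which determines it. -/
noncomputable def auMat (f : Au.{u} Q ⟶ A) : Matrix (Fin n) (Fin n) A :=
  Matrix.map (std Q) (alg f)

theorem auMat_auDesc (v : Matrix (Fin n) (Fin n) A) (h : AuRelations Q v (v.map star))
    (hv : IsCoefficientMatrix v) : auMat (auDesc v h hv) = v := by
  ext i j
  exact lift_std h i j

theorem auMat_comp (f : Au.{u} Q ⟶ A) (g : A ⟶ B) : auMat (f ≫ g) = (auMat f).map (alg g) := rfl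

theorem auMat_map_star (f : Au.{u} Q ⟶ A) :
    (auMat f).map star = Matrix.map (stdStar Q) (alg f) := by
  ext i j
  exact ((isHopfStarHom_alg f).map_star (std Q i j)).symm.trans (congrArg (alg f) (star_std Q i j))

theorem auMat_relations (f : Au.{u} Q ⟶ A) : AuRelations Q (auMat f) ((auMat f).map star) := by
  rw [auMat_map_star]
  exact (std_relations Q).map (alg f)

theorem auMat_isCoefficientMatrix (f : Au.{u} Q ⟶ A) : IsCoefficientMatrix (auMat f) :=
  (std_isCoefficientMatrix Q).map (isHopfStarHom_alg f)

theorem auMat_mem_unitary (f : Au.{u} Q ⟶ A) : auMat f ∈ unitary (Matrix (Fin n) (Fin n) A) :=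
  (isHopfStarHom_alg f).map_mem_unitary (std_mem_unitary Q)

theorem au_hom_ext {f g : Au.{u} Q ⟶ A} (h : auMat f = auMat g) : f = g := by
  have h_star : (auMat f).map star = (auMat g).map star := by rw [h]
  rw [auMat_map_star, auMat_map_star] at h_star
  exact hom_ext <| AlgHom.congr_fun <| AuAlgebra.algHom_ext
    (fun i j => congrFun (congrFun h i) j) (fun i j => congrFun (congrFun h_star i) j)

section FilteredColimit

variable {J : Type u} [SmallCategory J] [IsFiltered J] {F : J ⥤ CQG.{u}} {c : Cocone F}
  (hc : IsColimit c) {j : J}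
include hc

theorem auRelations_exists_map {v w : Matrix (Fin n) (Fin n) (F.obj j)}
    (h : AuRelations Q (v.map (alg (c.ι.app j))) (w.map (alg (c.ι.app j)))) :
    ∃ (k : J) (f : j ⟶ k), AuRelations Q (v.map (alg (F.map f))) (w.map (alg (F.map f))) := by
  let x : Fin 4 → Matrix (Fin n) (Fin n) (F.obj j) :=
    ![v * w.transpose, w.transpose * v, twist Q w * twistAdj Q v, twistAdj Q v * twist Q w]
  have map_app_eq_one : ∀ i, (x i).map (alg (c.ι.app j)) = 1 := by
    simp only [x, Fin.forall_fin_succ, Matrix.cons_val_zero, Matrix.cons_val_succ]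
    simp [Matrix.map_mul, Matrix.transpose_map, twist_map, twistAdj_map, h.mul_adjoint,
      h.adjoint_mul, h.twist_mul_adjoint, h.adjoint_mul_twist]
  obtain ⟨k, f, hf⟩ := exists_hom_forall_of_finite (ι := Fin 4)
    (P := fun i k f => (x i).map (alg (F.map f)) = (1 : Matrix _ _ _).map (alg (F.map f)))
    (fun i k l f g h => by
      simp only [F.map_comp, alg_comp, AlgHom.coe_comp, ← Matrix.map_map, h])
    (fun i => exists_matrix_map_eq hc (by simp [map_app_eq_one i]))
  refine ⟨k, f, ?_, ?_, ?_, ?_⟩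
  · simpa [x, Matrix.map_mul, Matrix.transpose_map] using hf 0
  · simpa [x, Matrix.map_mul, Matrix.transpose_map] using hf 1
  · simpa [x, Matrix.map_mul, twist_map, twistAdj_map] using hf 2
  · simpa [x, Matrix.map_mul, twist_map, twistAdj_map] using hf 3

theorem isCoefficientMatrix_exists_map {ι : Type*} [Fintype ι] [DecidableEq ι]
    {v : Matrix ι ι (F.obj j)} (h : IsCoefficientMatrix (v.map (alg (c.ι.app j)))) :
    ∃ (k : J) (f : j ⟶ k), IsCoefficientMatrix (v.map (alg (F.map f))) := by
  obtain ⟨k, f, hf⟩ := exists_hom_forall_of_finite (ι := ι × ι)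
    (P := fun i k f => Algebra.TensorProduct.map (alg (F.map f)) (alg (F.map f))
        (Coalgebra.comul (R := ℂ) (v i.1 i.2)) =
      Algebra.TensorProduct.map (alg (F.map f)) (alg (F.map f)) (∑ k, v i.1 k ⊗ₜ[ℂ] v k i.2))
    (fun i k l f g h => by rw [tensorMap_map_comp, tensorMap_map_comp, h])
    (fun i => exists_tensorMap_eq hc (by
      rw [← (isHopfStarHom_alg _).comul_map]
      simpa using h.comul_apply i.1 i.2))
  refine ⟨k, f, fun a b => ?_, fun a b => ?_⟩
  · rw [Matrix.map_apply, (isHopfStarHom_alg _).comul_map, hf (a, b)]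
    simp
  · rw [Matrix.map_apply, (isHopfStarHom_alg _).counit_map,
      ← (isHopfStarHom_alg (c.ι.app j)).counit_map]
    exact h.counit_apply a b

theorem exists_au_hom_comp_app_eq (f : Au.{u} Q ⟶ c.pt) :
    ∃ (j : J) (g : Au.{u} Q ⟶ F.obj j), g ≫ c.ι.app j = f := by
  obtain ⟨j, x, hx⟩ := exists_matrix_map_app_eq hc (auMat f)
  have app_comp {i k : J} (p : i ⟶ k) (v : Matrix (Fin n) (Fin n) (F.obj i)) :
      (v.map (alg (F.map p))).map (alg (c.ι.app k)) = v.map (alg (c.ι.app i)) := by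
    rw [← c.w p]
    rfl
  have relations_app := auMat_relations f
  rw [← hx, (isHopfStarHom_alg _).map_star_map] at relations_app
  obtain ⟨k, p, relations_k⟩ := auRelations_exists_map hc relations_app
  have coef_app := auMat_isCoefficientMatrix f
  rw [← hx, ← app_comp p] at coef_app
  obtain ⟨l, q, coef_l⟩ := isCoefficientMatrix_exists_map hc coef_app
  have relations_l := relations_k.map (alg (F.map q))
  rw [← (isHopfStarHom_alg _).map_star_map, ← (isHopfStarHom_alg _).map_star_map] at relations_l
  refine ⟨l, auDesc _ relations_l coef_l, au_hom_ext ?_⟩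
  rw [auMat_comp, auMat_auDesc, app_comp, app_comp, hx]

theorem exists_au_hom_comp_map_eq {f g : Au.{u} Q ⟶ F.obj j}
    (h : f ≫ c.ι.app j = g ≫ c.ι.app j) : ∃ (k : J) (p : j ⟶ k), f ≫ F.map p = g ≫ F.map p := by
  obtain ⟨k, p, hp⟩ := exists_matrix_map_eq hc (congrArg auMat h)
  exact ⟨k, p, au_hom_ext hp⟩

end FilteredColimit

variable (Q) in
theorem isFinitelyPresentable_au : IsFinitelyPresentable.{u} (Au.{u} Q) := by
  rw [isFinitelyPresentable_iff_preservesFilteredColimits]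
  refine ⟨fun J _ _ => ⟨fun {F} => ⟨fun {c} hc => ⟨?_⟩⟩⟩⟩
  refine Types.FilteredColimit.isColimitOf' _ _ (fun f => ?_) (fun j f g h => ?_)
  · obtain ⟨j, g, hg⟩ := exists_au_hom_comp_app_eq hc f
    exact ⟨j, g, hg.symm⟩
  · exact exists_au_hom_comp_map_eq hc h

end Au

end CQG

/-! ### Unitarizability and the double commutant theorem -/

namespace QuantumGroup

open scoped ComplexOrder
open Matrix

section TraceInnerProduct

variable {κ : Type*} [Fintype κ] [DecidableEq κ]

theorem exists_eq_sum_trace_conjTranspose_mul_smul {κ : Type*} [Fintype κ]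
    (V : Submodule ℂ (Matrix κ κ ℂ)) :
    ∃ (m : ℕ) (W : Fin m → Matrix κ κ ℂ), (∀ α, W α ∈ V) ∧
      ∀ X ∈ V, X = ∑ α, ((W α)ᴴ * X).trace • W α := by
  classical
  let _ : NormedAddCommGroup (Matrix κ κ ℂ) := toMatrixNormedAddCommGroup 1 PosDef.one
  let _ : InnerProductSpace ℂ (Matrix κ κ ℂ) := toMatrixInnerProductSpace 1 PosSemidef.one
  let b := stdOrthonormalBasis ℂ V
  refine ⟨_, fun α => b α, fun α => (b α).2, fun X hX => ?_⟩
  have h := congrArg Subtype.val (b.sum_repr' ⟨X, hX⟩)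
  rw [AddSubmonoidClass.coe_finsetSum] at h
  refine h.symm.trans (Finset.sum_congr rfl fun α _ => ?_)
  rw [trace_mul_comm]
  change (X * 1 * (b α : Matrix κ κ ℂ)ᴴ).trace • (b α : Matrix κ κ ℂ) = _
  rw [mul_one]

theorem exists_projection_comm_mulLeft (B : StarSubalgebra ℂ (Matrix κ κ ℂ)) :
    ∃ P : Matrix κ κ ℂ →ₗ[ℂ] Matrix κ κ ℂ,
      (∀ X, P X ∈ B) ∧ (∀ X ∈ B, P X = X) ∧ ∀ X ∈ B, ∀ Y, P (X * Y) = X * P Y := by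
  let _ : NormedAddCommGroup (Matrix κ κ ℂ) := toMatrixNormedAddCommGroup 1 PosDef.one
  let _ : InnerProductSpace ℂ (Matrix κ κ ℂ) := toMatrixInnerProductSpace 1 PosSemidef.one
  let _ : TopologicalSpace (Matrix κ κ ℂ) := PseudoMetricSpace.toUniformSpace.toTopologicalSpace
  have inner_mul_left_eq (X Y Z : Matrix κ κ ℂ) : inner ℂ (X * Y) Z = inner ℂ Y (Xᴴ * Z) := by
    change (Z * 1 * (X * Y)ᴴ).trace = (Xᴴ * Z * 1 * Yᴴ).trace
    rw [conjTranspose_mul, mul_one, mul_one, ← mul_assoc, trace_mul_comm, mul_assoc]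
  let V := Subalgebra.toSubmodule B.toSubalgebra
  refine ⟨V.starProjection.toLinearMap, V.starProjection_apply_mem,
    fun X hX => V.starProjection_eq_self_iff.2 hX, fun X hX Y => ?_⟩
  refine Submodule.eq_starProjection_of_mem_of_inner_eq_zero
    (B.mul_mem hX (V.starProjection_apply_mem Y)) fun Z hZ => ?_
  change inner ℂ (X * Y - X * V.starProjection Y) Z = 0
  rw [← mul_sub, inner_mul_left_eq]
  exact V.starProjection_inner_eq_zero Y _ (B.mul_mem (star_mem (s := B) hX) hZ)

/-- Conjugation by a self-adjoint matrix is self-adjoint for the trace inner product. -/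
theorem iSup_eigenspace_mulLeft_inv_comp_mulRight {R : Matrix κ κ ℂ} (hR : R.IsHermitian) :
    ⨆ μ, Module.End.eigenspace (LinearMap.mulLeft ℂ R⁻¹ ∘ₗ LinearMap.mulRight ℂ R) μ = ⊤ := by
  let _ : NormedAddCommGroup (Matrix κ κ ℂ) := toMatrixNormedAddCommGroup 1 PosDef.one
  let _ : InnerProductSpace ℂ (Matrix κ κ ℂ) := toMatrixInnerProductSpace 1 PosSemidef.one
  have hsymm : LinearMap.IsSymmetric (𝕜 := ℂ) (E := Matrix κ κ ℂ)
      (LinearMap.mulLeft ℂ R⁻¹ ∘ₗ LinearMap.mulRight ℂ R) := by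
    intro X Y
    change (Y * 1 * (R⁻¹ * (X * R))ᴴ).trace = (R⁻¹ * (Y * R) * 1 * Xᴴ).trace
    rw [conjTranspose_mul, conjTranspose_mul, conjTranspose_nonsing_inv, hR.eq, mul_one, mul_one,
      ← mul_assoc, ← mul_assoc, trace_mul_comm _ R⁻¹]
    simp only [mul_assoc]
  rw [← Submodule.orthogonal_eq_bot_iff]
  exact hsymm.orthogonalComplement_iSup_eigenspaces_eq_bot

end TraceInnerProduct

section Unitarize

variable {ι κ : Type*} [Fintype ι] [DecidableEq ι] [Fintype κ] [DecidableEq κ]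

theorem posDef_sum_mul_conjTranspose {J : Type*} [Fintype J] {M : J → Matrix ι ι ℂ}
    (h : 1 ∈ Submodule.span ℂ (Set.range M)) : (∑ α, M α * (M α)ᴴ).PosDef := by
  let N : Matrix ι (J × ι) ℂ := of fun i p => M p.1 i p.2
  have sum_eq : ∑ α, M α * (M α)ᴴ = N * Nᴴ := by
    ext i j
    simp [N, Matrix.sum_apply, Matrix.mul_apply, Fintype.sum_prod_type]
  rw [sum_eq]
  refine PosDef.mul_conjTranspose_self N
    ((injective_iff_map_eq_zero N.vecMulLinear).2 fun x hx => ?_)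
  have span_le : Submodule.span ℂ (Set.range M) ≤ LinearMap.ker (vecMulBilin ℂ ℂ x) := by
    rw [Submodule.span_le]
    rintro _ ⟨α, rfl⟩
    ext k
    exact congrFun hx (α, k)
  simpa using span_le h

/-- The matrix `R` is `∑ σ(d) σ(d)ᴴ`, the sum running over elements `d` of `D` whose images under
`ρ` form an orthonormal basis of the range of `ρ`. -/
theorem exists_posDef_intertwining {D : Type*} [Ring D] [Algebra ℂ D] (s : D → D)
    {ρ : D →ₐ[ℂ] Matrix κ κ ℂ} (hρ : ∀ a, ρ (s a) = (ρ a)ᴴ) {σ : D →ₐ[ℂ] Matrix ι ι ℂ}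
    (h : ∀ a, ρ a = 0 → σ a = 0) :
    ∃ R : Matrix ι ι ℂ, R.PosDef ∧ ∀ a, σ a * R = R * (σ (s a))ᴴ := by
  obtain ⟨m, W, hW, expand⟩ :=
    exists_eq_sum_trace_conjTranspose_mul_smul (LinearMap.range ρ.toLinearMap)
  choose d hd using hW
  replace hd (α) : ρ (d α) = W α := hd α
  have expand_σ (a : D) : σ a = ∑ β, ((W β)ᴴ * ρ a).trace • σ (d β) := by
    have map_sub_eq_zero : ρ (a - ∑ β, ((W β)ᴴ * ρ a).trace • d β) = 0 := by
      simpa [hd, sub_eq_zero] using expand (ρ a) ⟨a, rfl⟩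
    simpa [sub_eq_zero] using h _ map_sub_eq_zero
  refine ⟨∑ α, σ (d α) * (σ (d α))ᴴ, posDef_sum_mul_conjTranspose ?_, fun a => ?_⟩
  · rw [← map_one σ, expand_σ]
    exact Submodule.sum_mem _ fun β _ => Submodule.smul_mem _ _ (Submodule.subset_span ⟨β, rfl⟩)
  · have left (α) : σ a * σ (d α) = ∑ β, ((W β)ᴴ * (ρ a * W α)).trace • σ (d β) := by
      rw [← map_mul, expand_σ, map_mul, hd]
    have right (β) : (σ (d β))ᴴ * (σ (s a))ᴴ =
        ∑ α, ((W β)ᴴ * (ρ a * W α)).trace • (σ (d α))ᴴ := by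
      rw [← conjTranspose_mul, ← map_mul, expand_σ, conjTranspose_sum]
      refine Finset.sum_congr rfl fun α _ => ?_
      rw [conjTranspose_smul, ← trace_conjTranspose, map_mul, hd, hρ]
      simp only [conjTranspose_mul, conjTranspose_conjTranspose, mul_assoc]
    rw [Finset.mul_sum, Finset.sum_mul]
    simp only [mul_assoc, right]
    simp only [← mul_assoc, left, Finset.sum_mul, Finset.mul_sum, smul_mul_assoc, mul_smul_comm]
    exact Finset.sum_comm

end Unitarize

section Scalar

variable {H : Type*} [Ring H] [Algebra ℂ H] {ι : Type*}

theorem map_functional_inj {x y : Matrix ι ι H} :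
    (∀ φ : H →ₗ[ℂ] ℂ, x.map φ = y.map φ) ↔ x = y := by
  refine ⟨fun h => ?_, fun h φ => h ▸ rfl⟩
  ext i j
  rw [← sub_eq_zero, ← Module.forall_dual_apply_eq_zero_iff ℂ]
  intro φ
  rw [map_sub, sub_eq_zero]
  exact congrFun (congrFun (h φ) i) j

variable [Fintype ι]

theorem mul_algebraMap_map_functional (x : Matrix ι ι H) (M : Matrix ι ι ℂ) (φ : H →ₗ[ℂ] ℂ) :
    (x * M.map (algebraMap ℂ H)).map φ = x.map φ * M := by
  ext i j
  simp [Matrix.mul_apply, ← Algebra.commutes, ← Algebra.smul_def, mul_comm]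

theorem algebraMap_mul_map_functional (x : Matrix ι ι H) (M : Matrix ι ι ℂ) (φ : H →ₗ[ℂ] ℂ) :
    (M.map (algebraMap ℂ H) * x).map φ = M * x.map φ := by
  ext i j
  simp [Matrix.mul_apply, ← Algebra.smul_def]

end Scalar

section FunctionalRep

variable {H : Type*} [Ring H] [HopfAlgebra ℂ H] {ι κ : Type*} [Fintype ι] [DecidableEq ι]
  [Fintype κ] [DecidableEq κ] {x : Matrix ι ι H}

/-- The representation `φ ↦ φ(x)` of the convolution algebra of linear functionals that a comodule
with coefficient matrix `x` gives rise to. -/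
noncomputable def IsCoefficientMatrix.functionalRep (hx : IsCoefficientMatrix x) :
    WithConv (H →ₗ[ℂ] ℂ) →ₐ[ℂ] Matrix ι ι ℂ :=
  AlgHom.ofLinearMap
    { toFun φ := x.map φ
      map_add' _ _ := rfl
      map_smul' _ _ := rfl }
    (by
      ext i j
      exact hx.counit_apply i j)
    (fun φ ψ => by
      ext i j
      change (φ * ψ).ofConv (x i j) = (x.map φ.ofConv * x.map ψ.ofConv) i j
      simp [LinearMap.convMul_def, hx.comul_apply, Matrix.mul_apply])

variable [StarRing H] [StarModule ℂ H]

/-- The adjoint functional `a ↦ conj (φ (S(a)*))`, the involution of the convolution algebra of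
linear functionals for which unitary comodules give rise to `*`-representations. -/
noncomputable def functionalStar (φ : H →ₗ[ℂ] ℂ) : H →ₗ[ℂ] ℂ where
  toFun a := star (φ (star (HopfAlgebraStruct.antipode ℂ a)))
  map_add' a b := by simp
  map_smul' c a := by simp

theorem conjTranspose_map_functionalStar {ι : Type*} (x : Matrix ι ι H) (φ : H →ₗ[ℂ] ℂ) :
    (x.map (functionalStar φ))ᴴ = (star (x.map (HopfAlgebraStruct.antipode ℂ))).map φ := by
  ext i j
  simp [functionalStar, Matrix.star_apply]

theorem IsCoefficientMatrix.map_functionalStar (hx : IsCoefficientMatrix x)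
    (hx' : x ∈ unitary (Matrix ι ι H)) (φ : H →ₗ[ℂ] ℂ) :
    x.map (functionalStar φ) = (x.map φ)ᴴ := by
  ext i j
  simp [functionalStar, hx.antipode_apply hx']

/-- A comodule whose coefficients are linear combinations of those of a unitary comodule is
unitarizable. -/
theorem IsCoefficientMatrix.exists_posDef_mul_mul_star (hx : IsCoefficientMatrix x)
    {w : Matrix κ κ H} (hw : IsCoefficientMatrix w) (hw' : w ∈ unitary (Matrix κ κ H))
    (h : ∀ i j, x i j ∈ Submodule.span ℂ (Set.range fun p : κ × κ => w p.1 p.2)) :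
    ∃ R : Matrix ι ι ℂ, R.PosDef ∧
      x * R.map (algebraMap ℂ H) * star x = R.map (algebraMap ℂ H) := by
  have functionalRep_eq_zero (φ : WithConv (H →ₗ[ℂ] ℂ)) (hφ : hw.functionalRep φ = 0) :
      hx.functionalRep φ = 0 := by
    have span_le : Submodule.span ℂ (Set.range fun p : κ × κ => w p.1 p.2) ≤
        LinearMap.ker φ.ofConv := by
      rw [Submodule.span_le]
      rintro _ ⟨p, rfl⟩
      exact congrFun (congrFun hφ p.1) p.2
    ext i j
    exact span_le (h i j)
  obtain ⟨R, hR, intertwining⟩ := exists_posDef_intertwining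
    (fun φ => WithConv.toConv (functionalStar φ.ofConv))
    (fun φ => hw.map_functionalStar hw' φ.ofConv) functionalRep_eq_zero
  have mul_eq : x * R.map (algebraMap ℂ H) = R.map (algebraMap ℂ H) *
      star (x.map (HopfAlgebraStruct.antipode ℂ)) := by
    refine map_functional_inj.1 fun ψ => ?_
    rw [mul_algebraMap_map_functional, algebraMap_mul_map_functional,
      ← conjTranspose_map_functionalStar]
    exact intertwining (WithConv.toConv ψ)
  refine ⟨R, hR, ?_⟩
  rw [mul_eq, mul_assoc, ← star_mul, hx.mul_antipode, star_one, mul_one]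

end FunctionalRep

section DoubleCommutant

variable {κ : Type*} [Fintype κ] [DecidableEq κ]

/-- The matrices `P_{jl}` with `P(X)_{ij} = ∑ l, (P_{jl} X)_{il}`, for a linear map `P`. -/
def block (P : Matrix κ κ ℂ →ₗ[ℂ] Matrix κ κ ℂ) (j l : κ) : Matrix κ κ ℂ :=
  of fun i k => P (single k l 1) i j

theorem block_mul_apply (P : Matrix κ κ ℂ →ₗ[ℂ] Matrix κ κ ℂ) (j l : κ) (T : Matrix κ κ ℂ)
    (i k : κ) : (block P j l * T) i k = P (T * single k l 1) i j := by
  have mul_single : T * single k l 1 = ∑ p, T p k • single p l (1 : ℂ) := by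
    ext p q
    simp [Matrix.sum_apply, Matrix.single_apply, Matrix.mul_apply, ite_and]
  rw [mul_single, map_sum]
  simp only [map_smul, Matrix.sum_apply, Matrix.smul_apply, smul_eq_mul, Matrix.mul_apply, block,
    of_apply, mul_comm]

theorem forall_map_mul_eq_iff (P : Matrix κ κ ℂ →ₗ[ℂ] Matrix κ κ ℂ) (T : Matrix κ κ ℂ) :
    (∀ X, P (T * X) = T * P X) ↔ ∀ j l, block P j l * T = T * block P j l := by
  have mul_block_apply (j l i k) : (T * block P j l) i k = (T * P (single k l 1)) i j := rfl
  constructor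
  · intro h j l
    ext i k
    rw [block_mul_apply, h, mul_block_apply]
  · intro h
    refine DFunLike.congr_fun (f := P ∘ₗ LinearMap.mulLeft ℂ T)
      (g := LinearMap.mulLeft ℂ T ∘ₗ P) (Matrix.ext_linearMap ℂ fun k l => ?_)
    ext i j
    have entry_eq := congrFun (congrFun (h j l) i) k
    rwa [block_mul_apply, mul_block_apply] at entry_eq

/-- The orthogonal projection onto `B` commutes with left multiplication by `B`, so that its blocks
commute with `B` and hence with `T`; therefore it fixes `T = T * 1`. -/
theorem mem_of_mem_double_commutant (B : StarSubalgebra ℂ (Matrix κ κ ℂ)) {T : Matrix κ κ ℂ}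
    (hT : ∀ M : Matrix κ κ ℂ, (∀ X ∈ B, M * X = X * M) → M * T = T * M) : T ∈ B := by
  obtain ⟨P, P_mem, P_eq_self, P_mul⟩ := exists_projection_comm_mulLeft B
  have block_comm (j l : κ) : block P j l * T = T * block P j l :=
    hT _ fun X hX => (forall_map_mul_eq_iff P X).1 (P_mul X hX) j l
  have P_T : P T = T := by
    simpa [P_eq_self 1 B.one_mem] using (forall_map_mul_eq_iff P T).2 block_comm 1
  exact P_T ▸ P_mem T

end DoubleCommutant

section DirectSum

variable {ι κ : Type*} [Fintype ι] [DecidableEq ι] [Fintype κ] [DecidableEq κ]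

theorem IsCoefficientMatrix.fromBlocks {H : Type*} [Ring H] [HopfAlgebra ℂ H] {x : Matrix ι ι H}
    {y : Matrix κ κ H} (hx : IsCoefficientMatrix x) (hy : IsCoefficientMatrix y) :
    IsCoefficientMatrix (Matrix.fromBlocks x 0 0 y) where
  comul_apply i j := by
    rcases i with i | i <;> rcases j with j | j <;> simp [hx.comul_apply, hy.comul_apply]
  counit_apply i j := by
    rcases i with i | i <;> rcases j with j | j <;>
      simp [hx.counit_apply, hy.counit_apply, Matrix.one_apply]

theorem IsCoefficientMatrix.submatrix {H : Type*} [Ring H] [HopfAlgebra ℂ H] {x : Matrix ι ι H}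
    (hx : IsCoefficientMatrix x) (e : κ ≃ ι) : IsCoefficientMatrix (x.submatrix e e) where
  comul_apply i j := by
    rw [submatrix_apply, hx.comul_apply, ← e.sum_comp]
    rfl
  counit_apply i j := by
    rw [submatrix_apply, hx.counit_apply]
    simp [Matrix.one_apply]

variable {A : Type*} [Semiring A] [StarRing A] {x : Matrix ι ι A}

theorem fromBlocks_mem_unitary {y : Matrix κ κ A} (hx : x ∈ unitary (Matrix ι ι A))
    (hy : y ∈ unitary (Matrix κ κ A)) :
    fromBlocks x 0 0 y ∈ unitary (Matrix (ι ⊕ κ) (ι ⊕ κ) A) := by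
  simp only [Unitary.mem_iff, star_eq_conjTranspose] at hx hy ⊢
  simp [fromBlocks_conjTranspose, fromBlocks_multiply, hx, hy]

theorem submatrix_mem_unitary (hx : x ∈ unitary (Matrix ι ι A)) (e : κ ≃ ι) :
    x.submatrix e e ∈ unitary (Matrix κ κ A) := by
  simp only [Unitary.mem_iff, star_eq_conjTranspose] at hx ⊢
  simp [conjTranspose_submatrix, submatrix_mul_equiv, hx]

end DirectSum

section Unitary

variable {H : Type*} [Ring H] [HopfAlgebra ℂ H] [StarRing H]

theorem exists_subset_range_of_subset_unitaryCoefficients (s : Finset H)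
    (hs : ↑s ⊆ unitaryCoefficients H) :
    ∃ (k : ℕ) (w : Matrix (Fin k) (Fin k) H), IsCoefficientMatrix w ∧ w ∈ unitary (Matrix _ _ H) ∧
      ↑s ⊆ Set.range fun p : Fin k × Fin k => w p.1 p.2 := by
  classical
  induction s using Finset.induction_on with
  | empty =>
    exact ⟨0, 1, ⟨fun i => i.elim0, fun i => i.elim0⟩, one_mem _, by simp⟩
  | insert a s _ ih =>
    rw [Finset.coe_insert, Set.insert_subset_iff] at hs
    obtain ⟨m, x, hx, hx', i, j, rfl⟩ := hs.1
    obtain ⟨n, y, hy, hy', hys⟩ := ih hs.2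
    refine ⟨m + n, (fromBlocks x 0 0 y).submatrix finSumFinEquiv.symm finSumFinEquiv.symm,
      (hx.fromBlocks hy).submatrix _, submatrix_mem_unitary (fromBlocks_mem_unitary hx' hy') _, ?_⟩
    rw [Finset.coe_insert, Set.insert_subset_iff]
    refine ⟨⟨(finSumFinEquiv (.inl i), finSumFinEquiv (.inl j)), by simp⟩, fun b hb => ?_⟩
    obtain ⟨p, rfl⟩ := hys hb
    exact ⟨(finSumFinEquiv (.inr p.1), finSumFinEquiv (.inr p.2)), by simp⟩

theorem exists_subset_span_range_of_span_unitaryCoefficients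
    (hH : Submodule.span ℂ (unitaryCoefficients H) = ⊤) (s : Finset H) :
    ∃ (k : ℕ) (w : Matrix (Fin k) (Fin k) H), IsCoefficientMatrix w ∧ w ∈ unitary (Matrix _ _ H) ∧
      ↑s ⊆ (Submodule.span ℂ (Set.range fun p : Fin k × Fin k => w p.1 p.2) : Set H) := by
  obtain ⟨t, ht, hst⟩ := Submodule.subset_span_finite_of_subset_span
    (show ↑s ⊆ (Submodule.span ℂ (unitaryCoefficients H) : Set H) by simp [hH])
  obtain ⟨k, w, hw, hw', htw⟩ := exists_subset_range_of_subset_unitaryCoefficients t ht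
  exact ⟨k, w, hw, hw', hst.trans (Submodule.span_mono htw)⟩

theorem IsCoefficientMatrix.map_star [StarModule ℂ H] [IsHopfStarAlgebra H] {ι : Type*} [Fintype ι]
    [DecidableEq ι] {x : Matrix ι ι H} (hx : IsCoefficientMatrix x) :
    IsCoefficientMatrix (x.map star) where
  comul_apply i j := by simp [IsHopfStarAlgebra.comul_star, hx.comul_apply, star_sum]
  counit_apply i j := by simp [IsHopfStarAlgebra.counit_star, hx.counit_apply, Matrix.one_apply]

end Unitary

section Scalar

variable {H : Type*} [Ring H] [Algebra ℂ H] {ι : Type*} [Fintype ι] (M : Matrix ι ι ℂ)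
  (x : Matrix ι ι H)

theorem transpose_algebraMap_mul :
    (M.map (algebraMap ℂ H) * x)ᵀ = xᵀ * Mᵀ.map (algebraMap ℂ H) := by
  ext i j
  simp [Matrix.mul_apply, Algebra.commutes]

theorem transpose_mul_algebraMap :
    (x * M.map (algebraMap ℂ H))ᵀ = Mᵀ.map (algebraMap ℂ H) * xᵀ := by
  ext i j
  simp [Matrix.mul_apply, Algebra.commutes]

variable [StarRing H] [StarModule ℂ H]

theorem map_star_algebraMap_mul : (M.map (algebraMap ℂ H) * x).map star =
    (M.map star).map (algebraMap ℂ H) * x.map star := by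
  ext i j
  simp [Matrix.mul_apply, star_sum, ← algebraMap_star_comm, Algebra.commutes]

theorem map_star_mul_algebraMap : (x * M.map (algebraMap ℂ H)).map star =
    x.map star * (M.map star).map (algebraMap ℂ H) := by
  ext i j
  simp [Matrix.mul_apply, star_sum, ← algebraMap_star_comm, Algebra.commutes]

theorem map_algebraMap_mem_unitary [DecidableEq ι] {U : Matrix ι ι ℂ}
    (hU : U ∈ unitary (Matrix ι ι ℂ)) : U.map (algebraMap ℂ H) ∈ unitary (Matrix ι ι H) := by
  have star_map : star (U.map (algebraMap ℂ H)) = (star U).map (algebraMap ℂ H) := by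
    ext i j
    exact (algebraMap_star_comm _).symm
  rw [Unitary.mem_iff] at hU ⊢
  rw [star_map, ← Matrix.map_mul, ← Matrix.map_mul, hU.1, hU.2]
  simp

end Scalar

/-! ### Endomorphisms of comodules -/

section Commutant

variable {H : Type*} [Ring H] [Algebra ℂ H] {ι κ : Type*} [Fintype ι] [DecidableEq ι] [Fintype κ]
  [DecidableEq κ] {x : Matrix ι ι H} {M : Matrix ι ι ℂ}

/-- The algebra of endomorphisms of a comodule with coefficient matrix `x`: the complex matrices
that commute with `x`. -/
def commutant (x : Matrix ι ι H) : Subalgebra ℂ (Matrix ι ι ℂ) :=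
  (Subalgebra.centralizer ℂ {x}).comap (Algebra.ofId ℂ H).mapMatrix

theorem mem_commutant :
    M ∈ commutant x ↔ M.map (algebraMap ℂ H) * x = x * M.map (algebraMap ℂ H) := by
  rw [commutant, Subalgebra.mem_comap, Subalgebra.mem_centralizer_iff]
  simp only [Set.mem_singleton_iff, forall_eq]
  exact eq_comm

theorem mem_commutant_iff_functional :
    M ∈ commutant x ↔ ∀ φ : H →ₗ[ℂ] ℂ, M * x.map φ = x.map φ * M := by
  rw [mem_commutant, ← map_functional_inj]
  simp only [algebraMap_mul_map_functional, mul_algebraMap_map_functional]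

theorem submatrix_mem_commutant (e : κ ≃ ι) :
    M.submatrix e e ∈ commutant (x.submatrix e e) ↔ M ∈ commutant x := by
  rw [mem_commutant, mem_commutant, ← submatrix_map, submatrix_mul_equiv, submatrix_mul_equiv]
  exact (Matrix.reindex e.symm e.symm).injective.eq_iff
    (a := M.map (algebraMap ℂ H) * x) (b := x * M.map (algebraMap ℂ H))

theorem fromBlocks_zero_mem_commutant :
    fromBlocks 0 M 0 0 ∈ commutant (fromBlocks x 0 0 x) ↔ M ∈ commutant x := by
  rw [mem_commutant, mem_commutant, fromBlocks_map, fromBlocks_multiply, fromBlocks_multiply,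
    fromBlocks_inj]
  simp

theorem transpose_mem_commutant (h : M ∈ commutant x) : Mᵀ ∈ commutant xᵀ := by
  rw [mem_commutant] at h ⊢
  rw [← transpose_mul_algebraMap, ← transpose_algebraMap_mul, h]

theorem mem_commutant_iff_of_mem_unitary (hM : M ∈ unitary (Matrix ι ι ℂ)) :
    M ∈ commutant x ↔ M.map (algebraMap ℂ H) * x * Mᴴ.map (algebraMap ℂ H) = x := by
  have mul_conjTranspose : M.map (algebraMap ℂ H) * Mᴴ.map (algebraMap ℂ H) = 1 := by
    rw [← Matrix.map_mul, ← star_eq_conjTranspose, Unitary.mul_star_self_of_mem hM]; simp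
  have conjTranspose_mul : Mᴴ.map (algebraMap ℂ H) * M.map (algebraMap ℂ H) = 1 := by
    rw [← Matrix.map_mul, ← star_eq_conjTranspose, Unitary.star_mul_self_of_mem hM]; simp
  rw [mem_commutant]
  constructor <;> intro h
  · rw [h, mul_assoc, mul_conjTranspose, mul_one]
  · conv_rhs => rw [← h]
    rw [mul_assoc _ _ (M.map _), conjTranspose_mul, mul_one]

variable [StarRing H] [StarModule ℂ H]

theorem map_star_mem_commutant (h : M ∈ commutant x) : M.map star ∈ commutant (x.map star) := by
  rw [mem_commutant] at h ⊢
  rw [← map_star_algebraMap_mul, h, map_star_mul_algebraMap]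

theorem conjTranspose_mem_commutant (hx : x ∈ unitary (Matrix ι ι H)) (h : M ∈ commutant x) :
    Mᴴ ∈ commutant x := by
  have comm_star : Mᴴ.map (algebraMap ℂ H) * star x = star x * Mᴴ.map (algebraMap ℂ H) :=
    mem_commutant.1 (transpose_mem_commutant (map_star_mem_commutant h))
  rw [Unitary.mem_iff] at hx
  rw [mem_commutant]
  calc Mᴴ.map (algebraMap ℂ H) * x = x * (star x * Mᴴ.map (algebraMap ℂ H)) * x := by
        rw [← mul_assoc, hx.2, one_mul]
    _ = x * Mᴴ.map (algebraMap ℂ H) := by rw [← comm_star, mul_assoc, mul_assoc, hx.1, mul_one]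

end Commutant

theorem IsCoefficientMatrix.mul_mul_eq_iff {H : Type*} [Ring H] [HopfAlgebra ℂ H] {ι : Type*}
    [Fintype ι] [DecidableEq ι] {x y : Matrix ι ι H} (hx : IsCoefficientMatrix x)
    {R : Matrix ι ι ℂ} (hR : IsUnit R.det) :
    x * R.map (algebraMap ℂ H) * y = R.map (algebraMap ℂ H) ↔
      y * R⁻¹.map (algebraMap ℂ H) * x = R⁻¹.map (algebraMap ℂ H) := by
  have mul_inv : R.map (algebraMap ℂ H) * R⁻¹.map (algebraMap ℂ H) = 1 := by
    rw [← Matrix.map_mul, mul_nonsing_inv _ hR]; simp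
  have inv_mul : R⁻¹.map (algebraMap ℂ H) * R.map (algebraMap ℂ H) = 1 := by
    rw [← Matrix.map_mul, nonsing_inv_mul _ hR]; simp
  have := hx.mul_eq_one_comm (y := R.map (algebraMap ℂ H) * y * R⁻¹.map (algebraMap ℂ H))
  generalize R.map (algebraMap ℂ H) = r at *
  generalize R⁻¹.map (algebraMap ℂ H) = r' at *
  constructor <;> intro h
  · have left_inverse : r * y * r' * x = 1 :=
      this.1 (by rw [← mul_assoc, ← mul_assoc, h, mul_inv])
    calc y * r' * x = r' * (r * y * r' * x) := by simp only [← mul_assoc, inv_mul, one_mul]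
      _ = r' := by rw [left_inverse, mul_one]
  · have right_inverse : x * (r * y * r') = 1 :=
      this.2 (by rw [mul_assoc r, mul_assoc r, h, mul_inv])
    calc x * r * y = x * (r * y * r') * r := by simp only [mul_assoc, inv_mul, mul_one]
      _ = r := by rw [right_inverse, one_mul]

section IsCompatible

variable {H : Type*} [Ring H] [HopfAlgebra ℂ H] [StarRing H] {ι κ : Type*} [Fintype ι]
  [DecidableEq ι] [Fintype κ] [DecidableEq κ]

/-- The matrix `x` is the coefficient matrix of a unitary comodule and satisfies the relation
`xᵀ * Rᵀ * x̄ = Rᵀ`. For `R = Qᵀ` these are the defining relations of `A_u(Q)`; the transpose is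
placed so that `R` is what acts on the comodule, by conjugation on the endomorphisms. -/
structure IsCompatible (R : Matrix ι ι ℂ) (x : Matrix ι ι H) : Prop where
  coef : IsCoefficientMatrix x
  mem_unitary : x ∈ unitary (Matrix ι ι H)
  transpose_mul_mul : xᵀ * Rᵀ.map (algebraMap ℂ H) * x.map star = Rᵀ.map (algebraMap ℂ H)

namespace IsCompatible

variable {R : Matrix ι ι ℂ} {x : Matrix ι ι H}

theorem map (h : IsCompatible R x) {K : Type*} [Ring K] [HopfAlgebra ℂ K] [StarRing K]
    {f : H →ₐ[ℂ] K} (hf : IsHopfStarHom f) : IsCompatible R (x.map f) where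
  coef := h.coef.map hf
  mem_unitary := hf.map_mem_unitary h.mem_unitary
  transpose_mul_mul := by
    have map_scalar : (Rᵀ.map (algebraMap ℂ H)).map f = Rᵀ.map (algebraMap ℂ K) := by ext; simp
    rw [hf.map_star_map, ← transpose_map, ← map_scalar, ← Matrix.map_mul, ← Matrix.map_mul,
      h.transpose_mul_mul]

theorem submatrix (h : IsCompatible R x) (e : κ ≃ ι) :
    IsCompatible (R.submatrix e e) (x.submatrix e e) where
  coef := h.coef.submatrix e
  mem_unitary := submatrix_mem_unitary h.mem_unitary e
  transpose_mul_mul := by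
    simp only [transpose_submatrix, ← submatrix_map, submatrix_mul_equiv, h.transpose_mul_mul]

theorem fromBlocks (h : IsCompatible R x) (c : ℂ) :
    IsCompatible (fromBlocks (c • R) 0 0 R) (fromBlocks x 0 0 x) where
  coef := h.coef.fromBlocks h.coef
  mem_unitary := fromBlocks_mem_unitary h.mem_unitary h.mem_unitary
  transpose_mul_mul := by
    have map_smul : (c • Rᵀ).map (algebraMap ℂ H) = c • Rᵀ.map (algebraMap ℂ H) := by
      ext i j
      exact _root_.map_smul (Algebra.linearMap ℂ H) c (Rᵀ i j)
    simp [fromBlocks_transpose, fromBlocks_map, fromBlocks_multiply, map_smul,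
      h.transpose_mul_mul]

variable [StarModule ℂ H]

theorem conj {n : ℕ} {R U : Matrix (Fin n) (Fin n) ℂ} {x : Matrix (Fin n) (Fin n) H}
    (h : IsCompatible R x) (hU : U ∈ unitary (Matrix _ _ ℂ)) (hUR : U * R = R * U) :
    IsCompatible R (U.map (algebraMap ℂ H) * x * Uᴴ.map (algebraMap ℂ H)) where
  coef := h.coef.conj (Unitary.mul_star_self_of_mem hU)
  mem_unitary := mul_mem (mul_mem (map_algebraMap_mem_unitary hU) h.mem_unitary)
    (map_algebraMap_mem_unitary (Unitary.star_mem hU))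
  transpose_mul_mul := by
    have transpose_mul_bar : Uᵀ * U.map star = 1 := by
      rw [← transpose_one, ← Unitary.star_mul_self_of_mem hU, transpose_mul]; rfl
    have bar_mul_transpose : U.map star * Uᵀ = 1 := mul_eq_one_comm.1 transpose_mul_bar
    have comm : Uᵀ * Rᵀ = Rᵀ * Uᵀ := by rw [← transpose_mul, ← hUR, transpose_mul]
    rw [transpose_mul_algebraMap, transpose_algebraMap_mul, map_star_mul_algebraMap,
      map_star_algebraMap_mul, show Uᴴᵀ = U.map star from rfl, show Uᴴ.map star = Uᵀ by ext; simp]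
    calc _ = (U.map star).map (algebraMap ℂ H) * (xᵀ *
          (Uᵀ * Rᵀ * U.map star).map (algebraMap ℂ H) * x.map star) * Uᵀ.map (algebraMap ℂ H) := by
          simp only [Matrix.map_mul, mul_assoc]
      _ = (U.map star * (Rᵀ * Uᵀ)).map (algebraMap ℂ H) := by
          rw [comm, mul_assoc Rᵀ, transpose_mul_bar, mul_one, h.transpose_mul_mul]
          simp only [Matrix.map_mul, mul_assoc]
      _ = _ := by rw [← comm, ← mul_assoc, bar_mul_transpose, one_mul]

variable [IsHopfStarAlgebra H]

theorem bar_mul_mul (h : IsCompatible R x) (hR : IsUnit R.det) :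
    x.map star * (Rᵀ)⁻¹.map (algebraMap ℂ H) * xᵀ = (Rᵀ)⁻¹.map (algebraMap ℂ H) := by
  have hR' : IsUnit Rᵀ.det := by rwa [det_transpose]
  rw [h.coef.map_star.mul_mul_eq_iff (isUnit_nonsing_inv_det _ hR'),
    nonsing_inv_nonsing_inv _ hR', h.transpose_mul_mul]

theorem conj_mem_commutant (h : IsCompatible R x) (hR : IsUnit R.det) {M : Matrix ι ι ℂ}
    (hM : M ∈ commutant x) : R⁻¹ * M * R ∈ commutant x := by
  have comm_bar : Mᵀ ∈ commutant (x.map star) := by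
    simpa [conjTranspose, Matrix.map_map, Function.comp_def] using
      map_star_mem_commutant (conjTranspose_mem_commutant h.mem_unitary hM)
  have conj_mem : Rᵀ * Mᵀ * (Rᵀ)⁻¹ ∈ commutant xᵀ := by
    rw [mem_commutant] at comm_bar ⊢
    simp only [Matrix.map_mul]
    calc _ = xᵀ * Rᵀ.map (algebraMap ℂ H) * (x.map star * Mᵀ.map (algebraMap ℂ H)) *
          (Rᵀ)⁻¹.map (algebraMap ℂ H) * xᵀ := by
          rw [← mul_assoc (xᵀ * _), h.transpose_mul_mul]
      _ = xᵀ * (Rᵀ.map (algebraMap ℂ H) * Mᵀ.map (algebraMap ℂ H) *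
          (x.map star * (Rᵀ)⁻¹.map (algebraMap ℂ H) * xᵀ)) := by
          rw [← comm_bar]
          simp only [mul_assoc]
      _ = _ := by rw [h.bar_mul_mul hR]
  simpa [transpose_nonsing_inv, mul_assoc] using transpose_mem_commutant conj_mem

end IsCompatible

theorem exists_isCompatible [StarModule ℂ H] [IsHopfStarAlgebra H]
    (hH : Submodule.span ℂ (unitaryCoefficients H) = ⊤) {x : Matrix ι ι H}
    (hx : IsCoefficientMatrix x) (hx' : x ∈ unitary (Matrix ι ι H)) :
    ∃ R, R.PosDef ∧ IsCompatible R x := by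
  classical
  obtain ⟨k, w, hw, hw', hxw⟩ := exists_subset_span_range_of_span_unitaryCoefficients hH
    (Finset.univ.image fun p : ι × ι => star (x p.1 p.2))
  obtain ⟨R, hR, hRx⟩ := hx.map_star.exists_posDef_mul_mul_star hw hw' fun i j =>
    hxw (Finset.mem_coe.2 (Finset.mem_image_of_mem _ (Finset.mem_univ (i, j))))
  have star_bar : star (x.map star) = xᵀ := by ext; simp [Matrix.star_apply]
  rw [star_bar, hx.map_star.mul_mul_eq_iff ((isUnit_iff_isUnit_det _).1 hR.isUnit)] at hRx
  exact ⟨(R⁻¹)ᵀ, hR.inv.transpose, hx, hx', by rwa [transpose_transpose]⟩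

end IsCompatible

section PosDef

theorem posDef_fromBlocks {ι κ : Type*} [Finite ι] [Finite κ] {M : Matrix ι ι ℂ} {N : Matrix κ κ ℂ}
    (hM : M.PosDef) (hN : N.PosDef) : (fromBlocks M 0 0 N).PosDef := by
  classical
  have := Fintype.ofFinite ι
  have := Fintype.ofFinite κ
  have := hM.isUnit.invertible
  have h : (fromBlocks M 0 0 N).PosSemidef := by
    simpa using (PosDef.fromBlocks₁₁ (B := (0 : Matrix ι κ ℂ)) N hM).2
      (by simpa using hN.posSemidef)
  rw [h.posDef_iff_isUnit, Matrix.isUnit_iff_isUnit_det, det_fromBlocks_zero₂₁]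
  exact ((Matrix.isUnit_iff_isUnit_det _).1 hM.isUnit).mul
    ((Matrix.isUnit_iff_isUnit_det _).1 hN.isUnit)

variable {ι : Type*} [Fintype ι]

theorem trace_mul_mul_conjTranspose_pos {R T : Matrix ι ι ℂ} (hR : R.PosDef) (hT : T ≠ 0) :
    0 < (T * R * Tᴴ).trace := by
  have diag_eq (i : ι) : (T * R * Tᴴ).diag i = star (star (T i)) ⬝ᵥ R *ᵥ star (T i) := by
    rw [star_star, dotProduct_mulVec]
    rfl
  obtain ⟨i, hi⟩ := Function.ne_iff.1 hT
  refine Finset.sum_pos' (fun j _ => ?_) ⟨i, Finset.mem_univ i, ?_⟩ <;> rw [diag_eq]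
  · exact hR.posSemidef.dotProduct_mulVec_nonneg _
  · exact hR.dotProduct_mulVec_pos (star_ne_zero.2 hi)

theorem eigenvalue_pos {R T : Matrix ι ι ℂ} {μ : ℂ} (hR : R.PosDef) (hT : T ≠ 0)
    (h : T * R = μ • (R * T)) : 0 < μ := by
  have trace_eq : (T * R * Tᴴ).trace = μ * (Tᴴ * R * Tᴴᴴ).trace := by
    rw [h, smul_mul_assoc, trace_smul, smul_eq_mul, conjTranspose_conjTranspose, mul_assoc R,
      ← trace_mul_cycle, mul_assoc]
  exact pos_of_mul_pos_left (trace_eq ▸ trace_mul_mul_conjTranspose_pos hR hT)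
    (trace_mul_mul_conjTranspose_pos hR (by simpa using hT)).le

variable [DecidableEq ι]

open scoped Matrix.Norms.L2Operator in
theorem mem_span_unitary_of_mem {S : StarSubalgebra ℂ (Matrix ι ι ℂ)} {T : Matrix ι ι ℂ}
    (hT : T ∈ S) : T ∈ Submodule.span ℂ {U | U ∈ S ∧ U ∈ unitary (Matrix ι ι ℂ)} := by
  have : IsClosed (S : Set (Matrix ι ι ℂ)) :=
    (Subalgebra.toSubmodule S.toSubalgebra).closed_of_finiteDimensional
  let _ := StarSubalgebra.cstarAlgebra S
  have mem_span : (⟨T, hT⟩ : S) ∈ Submodule.span ℂ (unitary S : Set S) := by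
    rw [CStarAlgebra.span_unitary]; trivial
  have := Submodule.mem_map_of_mem (f := S.subtype.toLinearMap) mem_span
  rw [Submodule.map_span] at this
  refine Submodule.span_mono ?_ this
  rintro _ ⟨U, hU, rfl⟩
  exact ⟨U.2, Unitary.map_mem S.subtype hU⟩

end PosDef

end QuantumGroup

/-! ### The regular generator -/

namespace CQG

open scoped ComplexOrder
open Matrix

variable {A : CQG.{u}} {n : ℕ}

theorem exists_au_hom {R : Matrix (Fin n) (Fin n) ℂ} (hR : R.PosDef)
    {x : Matrix (Fin n) (Fin n) A} (h : IsCompatible R x) :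
    ∃ f : Au.{u} ⟨Rᵀ, hR.transpose⟩ ⟶ A, auMat f = x := by
  let Q : PosMatrix n := ⟨Rᵀ, hR.transpose⟩
  have root_inv_sq : Q.root⁻¹ * Q.root⁻¹ = Rᵀ⁻¹ := by rw [← Matrix.mul_inv_rev, Q.root_mul_root]
  have relations : AuRelations Q x (x.map star) := by
    apply AuRelations.of_rel
    · exact Unitary.mul_star_self_of_mem h.mem_unitary
    · exact Unitary.star_mul_self_of_mem h.mem_unitary
    · rw [← scalarMat_mul, root_inv_sq]
      exact h.bar_mul_mul ((isUnit_iff_isUnit_det _).1 hR.isUnit)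
    · rw [← scalarMat_mul, Q.root_mul_root]
      exact h.transpose_mul_mul
  exact ⟨auDesc x relations h.coef, auMat_auDesc ..⟩

theorem isCompatible_auMat {Q : PosMatrix n} (f : Au.{u} Q ⟶ A) :
    IsCompatible Q.1ᵀ (auMat f) where
  coef := auMat_isCoefficientMatrix f
  mem_unitary := auMat_mem_unitary f
  transpose_mul_mul := by
    have h := (auMat_relations f).rel₄
    rwa [← scalarMat_mul, Q.root_mul_root] at h

theorem exists_auMat_eq {x : Matrix (Fin n) (Fin n) A} (hx : IsCoefficientMatrix x)
    (hx' : x ∈ unitary (Matrix (Fin n) (Fin n) A)) :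
    ∃ (Q : PosMatrix n) (f : Au.{u} Q ⟶ A), auMat f = x := by
  obtain ⟨R, hR, h⟩ := exists_isCompatible A.span_unitaryCoefficients hx hx'
  exact ⟨_, exists_au_hom hR h⟩

theorem exists_sum_auMat_eq (a : A) : ∃ (n : ℕ) (Q : PosMatrix n) (f : Au.{u} Q ⟶ A)
    (c : Fin n × Fin n → ℂ), ∑ p, c p • auMat f p.1 p.2 = a := by
  obtain ⟨n, w, hw, hw', h⟩ := exists_subset_span_range_of_span_unitaryCoefficients
    A.span_unitaryCoefficients {a}
  obtain ⟨Q, f, rfl⟩ := exists_auMat_eq hw hw'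
  obtain ⟨c, hc⟩ := (Submodule.mem_span_range_iff_exists_fun ℂ).1 (h (Finset.mem_singleton_self a))
  exact ⟨n, Q, f, c, hc⟩

/-- The family of all the objects `A_u(Q)`. -/
noncomputable abbrev auFamily (Q : (n : ℕ) × PosMatrix n) : CQG.{u} := Au.{u} Q.2

theorem isSeparating_au : (ObjectProperty.ofObj auFamily.{u}).IsSeparating := by
  intro A B f g h
  refine hom_ext fun a => ?_
  obtain ⟨n, Q, p, c, rfl⟩ := exists_sum_auMat_eq a
  have comp_eq := congrArg auMat (h (Au Q) (ObjectProperty.ofObj_apply auFamily ⟨n, Q⟩) p)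
  simp only [map_sum, map_smul]
  exact Finset.sum_congr rfl fun i _ => congrArg _ (congrFun (congrFun comp_eq i.1) i.2)

section Coequalizer

variable {X Y S : CQG.{u}}

/-- The morphism `s` coequalizes all pairs of morphisms from the `A_u(Q)` that are coequalized by
`π`. -/
def CoequalizesAu (π : Y ⟶ X) (s : Y ⟶ S) : Prop :=
  ∀ (n : ℕ) (Q : PosMatrix n) (p q : Au.{u} Q ⟶ Y), p ≫ π = q ≫ π → p ≫ s = q ≫ s

namespace CoequalizesAu

variable {π : Y ⟶ X} {s : Y ⟶ S} (hs : CoequalizesAu π s)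
include hs

theorem map_eq {R : Matrix (Fin n) (Fin n) ℂ} (hR : R.PosDef) {x y : Matrix (Fin n) (Fin n) Y}
    (hx : IsCompatible R x) (hy : IsCompatible R y) (e : x.map (alg π) = y.map (alg π)) :
    x.map (alg s) = y.map (alg s) := by
  obtain ⟨p, rfl⟩ := exists_au_hom hR hx
  obtain ⟨q, rfl⟩ := exists_au_hom hR hy
  exact congrArg auMat (hs n _ p q (au_hom_ext e))

/-- A unitary endomorphism `U` of `x` over `X` gives two lifts `x` and `U * x * Uᴴ` of the same
comodule to `Y`, which `s` must identify. -/
theorem mem_commutant_of_unitary {R : Matrix (Fin n) (Fin n) ℂ} (hR : R.PosDef)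
    {x : Matrix (Fin n) (Fin n) Y} (h : IsCompatible R x) {U : Matrix (Fin n) (Fin n) ℂ}
    (hU : U ∈ unitary (Matrix (Fin n) (Fin n) ℂ)) (hUR : U * R = R * U)
    (hc : U ∈ commutant (x.map (alg π))) : U ∈ commutant (x.map (alg s)) := by
  have map_conj {Z : CQG.{u}} (f : Y ⟶ Z) :
      (U.map (algebraMap ℂ Y) * x * Uᴴ.map (algebraMap ℂ Y)).map (alg f) =
        U.map (algebraMap ℂ Z) * x.map (alg f) * Uᴴ.map (algebraMap ℂ Z) := by
    simp [Matrix.map_mul, Matrix.map_map, Function.comp_def]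
  rw [mem_commutant_iff_of_mem_unitary hU, ← map_conj] at hc ⊢
  exact hs.map_eq hR (h.conj hU hUR) h hc

variable {ι : Type*} [Fintype ι] [DecidableEq ι] {R T : Matrix ι ι ℂ} {x : Matrix ι ι Y}

theorem mem_commutant_of_commute (hR : R.PosDef) (h : IsCompatible R x) (hTR : T * R = R * T)
    (hc : T ∈ commutant (x.map (alg π))) : T ∈ commutant (x.map (alg s)) := by
  have unitary_le {U : Matrix ι ι ℂ} (hU : U ∈ unitary (Matrix ι ι ℂ)) (hUR : U * R = R * U)
      (hc : U ∈ commutant (x.map (alg π))) : U ∈ commutant (x.map (alg s)) := by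
    let e := (Fintype.equivFin ι).symm
    rw [← submatrix_mem_commutant e, submatrix_map] at hc ⊢
    exact hs.mem_commutant_of_unitary (hR.submatrix e.injective) (h.submatrix e)
      (submatrix_mem_unitary hU e) (by simp only [submatrix_mul_equiv, hUR]) hc
  let D : StarSubalgebra ℂ (Matrix ι ι ℂ) :=
    { commutant (x.map (alg π)) with
      star_mem' := conjTranspose_mem_commutant (h.map (isHopfStarHom_alg π)).mem_unitary } ⊓
    StarSubalgebra.centralizer ℂ {R}
  have mem_centralizer {M : Matrix ι ι ℂ} :
      M ∈ StarSubalgebra.centralizer ℂ {R} ↔ M * R = R * M := by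
    simp [StarSubalgebra.mem_centralizer_iff, star_eq_conjTranspose, hR.isHermitian.eq, eq_comm]
  refine (Submodule.span_le (p := Subalgebra.toSubmodule (commutant (x.map (alg s))))).2 ?_
    (mem_span_unitary_of_mem (S := D) ⟨hc, mem_centralizer.2 hTR⟩)
  rintro U ⟨⟨hUc, hUR⟩, hU⟩
  exact unitary_le hU (mem_centralizer.1 hUR) hUc

/-- Doubling the comodule turns `T` into an off-diagonal block that commutes with the positive
definite matrix `diag(μ R, R)`. -/
theorem mem_commutant_of_eigenvector (hR : R.PosDef) (h : IsCompatible R x) {μ : ℂ} (hμ : 0 < μ)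
    (hTR : T * R = μ • (R * T)) (hc : T ∈ commutant (x.map (alg π))) :
    T ∈ commutant (x.map (alg s)) := by
  have map_blocks {Z : CQG.{u}} (f : Y ⟶ Z) : (fromBlocks x 0 0 x).map (alg f) =
      fromBlocks (x.map (alg f)) 0 0 (x.map (alg f)) := by
    simp [fromBlocks_map]
  rw [← fromBlocks_zero_mem_commutant, ← map_blocks] at hc ⊢
  refine hs.mem_commutant_of_commute (posDef_fromBlocks (hR.smul hμ) hR) (h.fromBlocks μ) ?_ hc
  simp [fromBlocks_multiply, hTR]

theorem commutant_le (hR : R.PosDef) (h : IsCompatible R x) :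
    commutant (x.map (alg π)) ≤ commutant (x.map (alg s)) := by
  have hdet : IsUnit R.det := (isUnit_iff_isUnit_det _).1 hR.isUnit
  have eq_iSup := Submodule.eq_iSup_inf_genEigenspace
    (p := Subalgebra.toSubmodule (commutant (x.map (alg π))))
    (f := LinearMap.mulLeft ℂ R⁻¹ ∘ₗ LinearMap.mulRight ℂ R) 1
    (fun T hT => by
      have := (h.map (isHopfStarHom_alg π)).conj_mem_commutant hdet hT
      rwa [mul_assoc] at this)
    (iSup_eigenspace_mulLeft_inv_comp_mulRight hR.isHermitian)
  rw [← Subalgebra.toSubmodule.le_iff_le, eq_iSup]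
  refine iSup_le fun μ T ⟨hT, hTμ⟩ => ?_
  obtain rfl | hT0 := eq_or_ne T 0
  · exact Submodule.zero_mem _
  have mul_eq : T * R = μ • (R * T) := by
    have inv_mul_eq : R⁻¹ * (T * R) = μ • T := Module.End.mem_eigenspace_iff.1 hTμ
    rw [← mul_smul_comm, ← inv_mul_eq, ← mul_assoc, mul_nonsing_inv _ hdet, one_mul]
  exact hs.mem_commutant_of_eigenvector hR h (eigenvalue_pos hR hT0 mul_eq) mul_eq hT

theorem exists_map_functional_eq {Q : PosMatrix n} (f : Au.{u} Q ⟶ Y) (ψ : S →ₗ[ℂ] ℂ) :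
    ∃ φ : X →ₗ[ℂ] ℂ, ((auMat f).map (alg π)).map φ = ((auMat f).map (alg s)).map ψ := by
  have coef : IsCoefficientMatrix ((auMat f).map (alg π)) := auMat_isCoefficientMatrix (f ≫ π)
  have mem_unitary : (auMat f).map (alg π) ∈ unitary (Matrix (Fin n) (Fin n) X) :=
    auMat_mem_unitary (f ≫ π)
  let B : StarSubalgebra ℂ (Matrix (Fin n) (Fin n) ℂ) :=
    { coef.functionalRep.range with
      star_mem' := by
        rintro _ ⟨φ, rfl⟩
        exact ⟨.toConv (functionalStar φ.ofConv), coef.map_functionalStar mem_unitary φ.ofConv⟩ }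
  have mem_B : ((auMat f).map (alg s)).map ψ ∈ B := by
    refine mem_of_mem_double_commutant B fun M hM => ?_
    have hMπ : M ∈ commutant ((auMat f).map (alg π)) :=
      mem_commutant_iff_functional.2 fun φ => hM _ ⟨.toConv φ, rfl⟩
    have hMs := hs.commutant_le Q.2.transpose (isCompatible_auMat f) hMπ
    exact mem_commutant_iff_functional.1 hMs ψ
  obtain ⟨φ, hφ⟩ := mem_B
  exact ⟨φ.ofConv, hφ⟩

theorem alg_eq_zero {y : Y} (hy : alg π y = 0) : alg s y = 0 := by
  obtain ⟨n, Q, f, c, rfl⟩ := exists_sum_auMat_eq y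
  rw [← Module.forall_dual_apply_eq_zero_iff ℂ]
  intro ψ
  obtain ⟨φ, hφ⟩ := hs.exists_map_functional_eq f ψ
  have apply_eq (i j : Fin n) : φ (alg π (auMat f i j)) = ψ (alg s (auMat f i j)) :=
    congrFun (congrFun hφ i) j
  have map_sum_eq_zero := congrArg φ hy
  simp only [map_sum, map_smul, map_zero, apply_eq] at map_sum_eq_zero ⊢
  exact map_sum_eq_zero

end CoequalizesAu

end Coequalizer

section Descent

variable {X Y S : CQG.{u}} {π : Y ⟶ X} {s : Y ⟶ S}

/-- The factorization of `s` through the surjective morphism `π`, as a homomorphism of algebras. -/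
noncomputable def descAlg (hπ : Function.Surjective (alg π))
    (h : ∀ y, alg π y = 0 → alg s y = 0) : X →ₐ[ℂ] S :=
  (Ideal.Quotient.liftₐ (RingHom.ker (alg π)) (alg s) h).comp
    (Ideal.quotientKerAlgEquivOfSurjective hπ).symm.toAlgHom

variable (hπ : Function.Surjective (alg π)) (h : ∀ y, alg π y = 0 → alg s y = 0)

theorem descAlg_comp_alg : (descAlg hπ h).comp (alg π) = alg s := by
  ext y
  have symm_apply : (Ideal.quotientKerAlgEquivOfSurjective hπ).symm (alg π y) =
      Ideal.Quotient.mk (RingHom.ker (alg π)) y := by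
    rw [AlgEquiv.symm_apply_eq]
    rfl
  exact congrArg (Ideal.Quotient.liftₐ (RingHom.ker (alg π)) (alg s) h) symm_apply

/-- The factorization of `s` through the surjective morphism `π`. -/
noncomputable def descHom : X ⟶ S :=
  homMk (descAlg hπ h) <| (isHopfStarHom_alg π).of_comp_surjective hπ <|
    (descAlg_comp_alg hπ h).symm ▸ isHopfStarHom_alg s

@[simp]
theorem comp_descHom : π ≫ descHom hπ h = s :=
  hom_ext fun y => DFunLike.congr_fun (descAlg_comp_alg hπ h) y

include hπ in
theorem hom_ext_of_surjective {f g : X ⟶ S} (h : π ≫ f = π ≫ g) : f = g :=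
  hom_ext <| hπ.forall.2 fun y => congrArg (fun k => alg k y) h

end Descent

theorem surjective_of_factors {X Z : CQG.{u}} {π : Z ⟶ X}
    (h : ∀ (n : ℕ) (Q : PosMatrix n) (f : Au.{u} Q ⟶ X), ∃ g : Au.{u} Q ⟶ Z, g ≫ π = f) :
    Function.Surjective (alg π) := by
  intro x
  obtain ⟨n, Q, f, c, rfl⟩ := exists_sum_auMat_eq x
  obtain ⟨g, rfl⟩ := h n Q f
  exact ⟨∑ p, c p • auMat g p.1 p.2, by simp only [map_sum, map_smul]; rfl⟩

theorem isRegularGenerator_au : IsRegularGenerator (ObjectProperty.ofObj auFamily.{u}) := by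
  refine ⟨isSeparating_au, fun X => ?_⟩
  have := hasColimits.{u}
  let t : (Σ Q : (n : ℕ) × PosMatrix n, auFamily.{u} Q ⟶ X) → CQG.{u} := fun j => auFamily j.1
  let π : ∐ t ⟶ X := Sigma.desc fun j => j.2
  let s : (Σ Q : (n : ℕ) × PosMatrix n, { p : (auFamily.{u} Q ⟶ ∐ t) × (auFamily.{u} Q ⟶ ∐ t) //
      p.1 ≫ π = p.2 ≫ π }) → CQG.{u} := fun i => auFamily i.1
  let f : ∐ s ⟶ ∐ t := Sigma.desc fun i => i.2.1.1
  let g : ∐ s ⟶ ∐ t := Sigma.desc fun i => i.2.1.2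
  have w : f ≫ π = g ≫ π := Sigma.hom_ext _ _ fun i => by simpa [f, g] using i.2.2
  have hπ : Function.Surjective (alg π) := surjective_of_factors fun n Q k =>
    ⟨Sigma.ι t ⟨⟨n, Q⟩, k⟩, Sigma.ι_desc _ _⟩
  have coequalizesAu {S : CQG.{u}} (k : ∐ t ⟶ S) (hk : f ≫ k = g ≫ k) : CoequalizesAu π k := by
    intro n Q p q hpq
    simpa [f, g] using congrArg (Sigma.ι s ⟨⟨n, Q⟩, (p, q), hpq⟩ ≫ ·) hk
  have isColimit : IsColimit (Cofork.ofπ π w) := Cofork.IsColimit.mk _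
    (fun c => descHom hπ fun _ => (coequalizesAu c.π c.condition).alg_eq_zero)
    (fun _ => comp_descHom hπ _)
    (fun _ _ hm => hom_ext_of_surjective hπ (hm.trans (comp_descHom hπ _).symm))
  exact ⟨_, _, s, t, Cofan.mk (∐ s) (Sigma.ι s), Cofan.mk (∐ t) (Sigma.ι t), f, g, π, w,
    fun _ => ObjectProperty.ofObj_apply _ _, fun _ => ObjectProperty.ofObj_apply _ _,
    ⟨coproductIsCoproduct s⟩, ⟨coproductIsCoproduct t⟩, ⟨isColimit⟩⟩

theorem isLocallyFinitelyPresentable : IsLocallyFinitelyPresentable.{u} CQG.{u} := by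
  have := hasColimits.{u}
  have := Cardinal.fact_isRegular_aleph0.{u}
  rw [IsLocallyFinitelyPresentable, IsCardinalLocallyPresentable.iff_exists_isStrongGenerator]
  refine ⟨ObjectProperty.ofObj auFamily.{u}, inferInstance,
    ObjectProperty.IsStrongGenerator.mk_of_exists_extremalEpi.{u} fun X => ?_, ?_⟩
  · obtain ⟨_, J, _, t, _, Z, f, g, π, w, -, ht, -, ⟨hZ⟩, ⟨hπ⟩⟩ := isRegularGenerator_au.{u}.2 X
    have : IsRegularEpi π := ⟨⟨⟨_, f, g, w, hπ⟩⟩⟩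
    exact ⟨J, t, ht, Z, hZ, π, inferInstance⟩
  · rintro _ ⟨Q⟩
    exact isFinitelyPresentable_au Q.2

end CQG

/-- The category `CQG` of CQG algebras is cocomplete, every `A_u(Q)` is finitely presentable in it,
the set of all `A_u(Q)` is a regular generator, and `CQG` is locally finitely presentable. -/
theorem mainTheorem1 :
    HasColimits CQG.{u} ∧
    (∀ (n : ℕ) (Q : QuantumGroup.PosMatrix n),
      IsFinitelyPresentable.{u} (QuantumGroup.Au.{u} Q)) ∧
    IsRegularGenerator (ObjectProperty.ofObj
      (fun Q : (n : ℕ) × QuantumGroup.PosMatrix n => QuantumGroup.Au.{u} Q.2)) ∧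
    IsLocallyFinitelyPresentable.{u} CQG.{u} :=
  ⟨CQG.hasColimits, fun _ Q => CQG.isFinitelyPresentable_au Q, CQG.isRegularGenerator_au,
    CQG.isLocallyFinitelyPresentable⟩
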